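/- **Conventions.** For a finite set $A$ of qubits let $\mathcal H_A=\bigotimes_{i\in A}\mathbb C^2$. The Pauli group on $A$ is the group of operators on $\mathcal H_A$ generated by all $X_i$, $Z_i$ ($i\in A$) and the scalar $\sqrt{-1}$; the Clifford group on $A$ is its normaliser in the group of unitary operators of $\mathcal H_A$. A *signal* is an expression $s=c+\sum_{i\in J}s_i\in\mathbb Z_2$, where $c\in\mathbb Z_2$ is a constant and $s_i$ is the outcome of the measurement at qubit $i$; $J$ is its domain. The *commands* are: the entanglement $E_{ij}$ (controlled-$Z$ on $i\ne j$); the corrections $X_i^s$, $Z_i^s$ ($s$ a signal); and the measurements $[M_i^\alpha]^{s,t}$ ($\alpha\in\mathbb R$; $s,t$ signals), i.e. the destructive measurement of qubit $i$ in the basis $\frac1{\sqrt2}(|0\rangle\pm e^{i\alpha'}|1\rangle)$ with $\alpha'=(-1)^s\alpha+t\pi$, with outcome $s_i=0$ for the sign $+$ and $s_i=1$ for $-$. A measurement is of the $M^x$ kind if $\alpha=0$ and of the $M^y$ kind if $\alpha=\pi/2$ (with arbitrary $s,t$). A *pattern* consists of finite sets $V$, $I$, $O$, injections $I\to V$, $O\to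 V$ (whose images may overlap), and a finite sequence of commands on $V$ such that: no command depends on an outcome not yet measured; no command acts on a qubit already measured; and a qubit is measured if and only if it is not an output. A *branch* from $q\in\mathcal H_I$ to $q'\in\mathcal H_O$, $q'\neq0$, is a run of the commands in order, starting from $q$ on the inputs and $|+\rangle$ on every other qubit of $V$, choosing an outcome at each measurement and applying the corresponding bra without renormalisation, that ends in $q'$. The pattern is *deterministic* if any two $q',q''$ reached by branches from the same $q$ differ only by a scalar; it *implements* a unitary $U:\mathcal H_I\to\mathcal H_O$ if it is deterministic and, for every $q\ne0$, $U(q)$ equals $\frac{\|q\|}{\|q'\|}q'$ up to a global phase, where $q'$ is the end of a branch from $q$. **Theorem.** Let $Q$ be a finite set of qubits and $U$ a unitary operator on $\mathcal H_Q$. Then $U$ is in the Clifford group on $Q$ if and only if there exists a pattern $\mathfrak P$ with $I=O=Q$ (as abstract sets) that implements $U$ and whose measurements are all of the $M^x$ and $M^y$ kind. -/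

import Mathlib

noncomputable section

namespace OneWay

/-! ### Qubits -/

/-- The state space `⨂_{i ∈ A} ℂ²` of the qubits indexed by a finite set `A`: amplitudes over the
computational basis `A → {0,1}`, with the Hilbert norm. -/
abbrev Hil (A : Type*) : Type _ := EuclideanSpace ℂ (A → Fin 2)

section Operators

variable {A : Type*} [DecidableEq A]

/-- Flip the bit at `i`. -/
def flipBit (i : A) (x : A → Fin 2) : A → Fin 2 := Function.update x i (x i + 1)

theorem flipBit_flipBit (i : A) (x : A → Fin 2) : flipBit i (flipBit i x) = x := by
  have h : ∀ b : Fin 2, b + 1 + 1 = b := by decide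
  simp [flipBit, h]

/-- `flipBit i` as a permutation of the computational basis. -/
def flipPerm (i : A) : Equiv.Perm (A → Fin 2) where
  toFun := flipBit i
  invFun := flipBit i
  left_inv := flipBit_flipBit i
  right_inv := flipBit_flipBit i

variable [Fintype A]

/-- The Pauli operator `X_i`. -/
def pauliX (i : A) : Hil A ≃ₗᵢ[ℂ] Hil A :=
  LinearIsometryEquiv.piLpCongrLeft 2 ℂ ℂ (flipPerm i)

/-- The Pauli operator `Z_i`. -/
def pauliZ (i : A) : Hil A ≃ₗᵢ[ℂ] Hil A :=
  LinearIsometryEquiv.piLpCongrRight 2 fun x : A → Fin 2 =>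
    if x i = 1 then LinearIsometryEquiv.neg ℂ else LinearIsometryEquiv.refl ℂ ℂ

/-- The controlled-`Z` operator on the qubits `i`, `j`. -/
def ctrlZ (i j : A) : Hil A ≃ₗᵢ[ℂ] Hil A :=
  LinearIsometryEquiv.piLpCongrRight 2 fun x : A → Fin 2 =>
    if x i = 1 ∧ x j = 1 then LinearIsometryEquiv.neg ℂ else LinearIsometryEquiv.refl ℂ ℂ

/-- The scalar operator `√-1 • 1`. -/
def scalarI (A : Type*) [DecidableEq A] [Fintype A] : Hil A ≃ₗᵢ[ℂ] Hil A where
  toLinearEquiv := LinearEquiv.smulOfNeZero ℂ (Hil A) Complex.I Complex.I_ne_zero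
  norm_map' q := by
    change ‖Complex.I • q‖ = ‖q‖
    rw [norm_smul, Complex.norm_I, one_mul]

theorem pauliX_apply (i : A) (q : Hil A) (x : A → Fin 2) :
    pauliX i q x = q (flipBit i x) := rfl

theorem pauliZ_apply (i : A) (q : Hil A) (x : A → Fin 2) :
    pauliZ i q x = (if x i = 1 then -1 else 1) * q x := by
  by_cases h : x i = 1 <;> simp [pauliZ, h]

theorem ctrlZ_apply (i j : A) (q : Hil A) (x : A → Fin 2) :
    ctrlZ i j q x = (if x i = 1 ∧ x j = 1 then -1 else 1) * q x := by
  by_cases h : x i = 1 ∧ x j = 1 <;> simp [ctrlZ, h]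

theorem scalarI_apply (q : Hil A) : scalarI A q = Complex.I • q := rfl

/-- The Pauli group on the qubits `A`: the group of operators generated by the `X_i`, the `Z_i` and
the scalar `√-1`. -/
def pauliGroup (A : Type*) [DecidableEq A] [Fintype A] : Subgroup (Hil A ≃ₗᵢ[ℂ] Hil A) :=
  Subgroup.closure (Set.range pauliX ∪ Set.range pauliZ ∪ {scalarI A})

/-- The Clifford group on the qubits `A`: the normaliser of the Pauli group in the unitary group. -/
def cliffordGroup (A : Type*) [DecidableEq A] [Fintype A] : Subgroup (Hil A ≃ₗᵢ[ℂ] Hil A) :=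
  Subgroup.normalizer (pauliGroup A : Set (Hil A ≃ₗᵢ[ℂ] Hil A))

end Operators

/-- The orthonormal measurement basis at angle `α`: `measKet α 0 = (|0⟩ + e^{iα}|1⟩)/√2` and
`measKet α 1 = (|0⟩ - e^{iα}|1⟩)/√2`. -/
def measKet (α : ℝ) (b : ZMod 2) : Fin 2 → ℂ :=
  ![1 / (Real.sqrt 2 : ℂ), (-1) ^ b.val * Complex.exp (α * Complex.I) / (Real.sqrt 2 : ℂ)]

/-- The state `|+⟩`. -/
def ketPlus : Fin 2 → ℂ := measKet 0 0

/-! ### Commands and patterns -/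

/-- A signal `c + ∑_{i ∈ dom} s_i` in `ℤ/2`, where `s_i` is the outcome of the measurement at `i`
and `c` is a constant. -/
structure Signal (V : Type*) where
  const : ZMod 2
  dom : Finset V

/-- An outcome map: a partial map from qubits to `ℤ/2`. -/
abbrev Outcomes (V : Type*) : Type _ := V → Option (ZMod 2)

/-- The outcome map `Γ` contains the domain of the signal `s`. -/
def Signal.DefinedAt {V : Type*} (s : Signal V) (Γ : Outcomes V) : Prop :=
  ∀ i ∈ s.dom, (Γ i).isSome

/-- The value `s_Γ` of the signal `s` (meaningful when `s.DefinedAt Γ`). -/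
def Signal.value {V : Type*} (s : Signal V) (Γ : Outcomes V) : ZMod 2 :=
  s.const + ∑ i ∈ s.dom, (Γ i).getD 0

/-- The commands: entanglement `E_{ij}`, dependent corrections `X_i^s` and `Z_i^s`, and dependent
(destructive) measurement `[M_i^α]^{s,t}`. -/
inductive Command (V : Type*) where
  | ent (i j : V) (hij : i ≠ j)
  | corrX (i : V) (s : Signal V)
  | corrZ (i : V) (s : Signal V)
  | meas (α : ℝ) (i : V) (s t : Signal V)

namespace Command

variable {V : Type*} [DecidableEq V]

/-- The qubits on which a command acts. -/
def qubits : Command V → Finset V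
  | ent i j _ => {i, j}
  | corrX i _ => {i}
  | corrZ i _ => {i}
  | meas _ i _ _ => {i}

/-- The qubits on whose measurement outcomes a command depends. -/
def deps : Command V → Finset V
  | ent _ _ _ => ∅
  | corrX _ s => s.dom
  | corrZ _ s => s.dom
  | meas _ _ s t => s.dom ∪ t.dom

/-- The qubits measured by a command. -/
def measures : Command V → Finset V
  | meas _ i _ _ => {i}
  | _ => ∅

/-- If the command is a measurement, it is of the kind `M^x` (angle `0`) or `M^y` (angle `π/2`),
possibly with dependencies. -/
def IsPauli : Command V → Prop
  | meas α _ _ _ => α = 0 ∨ α = Real.pi / 2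
  | _ => True

end Command

/-- The qubits measured by a command sequence. -/
def measured {V : Type*} [DecidableEq V] (l : List (Command V)) : Finset V :=
  l.foldr (fun c S => c.measures ∪ S) ∅

/-- A pattern with computation space `V`, inputs `I` and outputs `O`. The list of commands is in
order of execution: its head is executed first. -/
structure Pattern (V I O : Type*) where
  inp : I ↪ V
  out : O ↪ V
  cmds : List (Command V)

/-! ### Running a pattern -/

/-- A computation state: a quantum state on the qubits `live` that have not been consumed, and an
outcome map. -/
structure CState (V : Type*) [DecidableEq V] where
  live : Finset V
  state : Hil live
  outcomes : Outcomes V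

section Run

variable {V I O : Type*} [DecidableEq V]

/-- Extend a bit assignment on `W \ {i}` to one on `W` by the value `b` at `i`. -/
def extendBit {W : Finset V} (i : V) (x : ↥(W.erase i) → Fin 2) (b : Fin 2) : ↥W → Fin 2 :=
  fun k => if h : (k : V) = i then b else x ⟨k, Finset.mem_erase.mpr ⟨h, k.2⟩⟩

/-- The linear form `⟨ψ|` applied at the qubit `i`. -/
def applyBra {W : Finset V} (i : V) (ψ : Fin 2 → ℂ) (q : Hil ↥W) : Hil ↥(W.erase i) :=
  WithLp.toLp 2 fun x => ∑ b : Fin 2, (starRingEnd ℂ) (ψ b) * q (extendBit i x b)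

/-- The actual angle `(-1)^{s_Γ} α + t_Γ π` of the measurement `[M^α]^{s,t}`. -/
def actualAngle (α : ℝ) (s t : Signal V) (Γ : Outcomes V) : ℝ :=
  (-1) ^ (s.value Γ).val * α + (t.value Γ).val * Real.pi

/-- The action of the commands on computation states, without renormalisation. A measurement has two
possible outcomes `b`. -/
inductive Step : Command V → CState V → CState V → Prop
  | ent {W : Finset V} {q : Hil ↥W} {Γ : Outcomes V} {i j : V} (hij : i ≠ j)
      (hi : i ∈ W) (hj : j ∈ W) :
      Step (.ent i j hij) ⟨W, q, Γ⟩ ⟨W, ctrlZ ⟨i, hi⟩ ⟨j, hj⟩ q, Γ⟩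
  | corrX {W : Finset V} {q : Hil ↥W} {Γ : Outcomes V} {i : V} {s : Signal V}
      (hi : i ∈ W) (hs : s.DefinedAt Γ) :
      Step (.corrX i s) ⟨W, q, Γ⟩ ⟨W, (pauliX ⟨i, hi⟩ ^ (s.value Γ).val) q, Γ⟩
  | corrZ {W : Finset V} {q : Hil ↥W} {Γ : Outcomes V} {i : V} {s : Signal V}
      (hi : i ∈ W) (hs : s.DefinedAt Γ) :
      Step (.corrZ i s) ⟨W, q, Γ⟩ ⟨W, (pauliZ ⟨i, hi⟩ ^ (s.value Γ).val) q, Γ⟩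
  | meas {W : Finset V} {q : Hil ↥W} {Γ : Outcomes V} {α : ℝ} {i : V} {s t : Signal V}
      (hi : i ∈ W) (hs : s.DefinedAt Γ) (ht : t.DefinedAt Γ) (b : ZMod 2) :
      Step (.meas α i s t) ⟨W, q, Γ⟩
        ⟨W.erase i, applyBra i (measKet (actualAngle α s t Γ) b) q,
          Function.update Γ i (some b)⟩

/-- Execution of a sequence of commands, head first. -/
inductive Exec : List (Command V) → CState V → CState V → Prop
  | nil (S : CState V) : Exec [] S S
  | cons {c : Command V} {l : List (Command V)} {S S' S'' : CState V}
      (h : Step c S S') (hl : Exec l S' S'') : Exec (c :: l) S S''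

namespace Pattern

variable (P : Pattern V I O)

/-- (D0) no command depends on an outcome not yet measured; (D1) no command acts on a qubit already
measured; (D2) a qubit is measured if and only if it is not an output. -/
structure Definite : Prop where
  d0 : ∀ l₁ c l₂, P.cmds = l₁ ++ c :: l₂ → c.deps ⊆ measured l₁
  d1 : ∀ l₁ c l₂, P.cmds = l₁ ++ c :: l₂ → Disjoint c.qubits (measured l₁)
  d2 : ∀ i : V, i ∈ measured P.cmds ↔ i ∉ Set.range P.out

/-- All measurements are of the `M^x` and `M^y` kind. -/
def PauliMeasurements : Prop := ∀ c ∈ P.cmds, c.IsPauli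

variable [Fintype V]

open Classical in
/-- The state `q ⊗ |+…+⟩` on all of `V`. -/
def prep (q : Hil I) : Hil ↥(Finset.univ : Finset V) :=
  WithLp.toLp 2 fun x =>
    q (fun k => x ⟨P.inp k, Finset.mem_univ _⟩) *
      ∏ v ∈ Finset.univ.filter (fun v : V => v ∉ Set.range P.inp),
        ketPlus (x ⟨v, Finset.mem_univ _⟩)

variable [Fintype O]

/-- The qubits of `V` that are outputs. -/
def outputs : Finset V := Finset.univ.map P.out

/-- A state of the output qubits, seen as a state on the corresponding qubits in `V`. -/
def embedOut (q' : Hil O) : Hil ↥P.outputs :=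
  WithLp.toLp 2 fun x =>
    q' (fun k => x ⟨P.out k, Finset.mem_map_of_mem P.out (Finset.mem_univ k)⟩)

/-- There is a branch of the pattern from the input state `q` to the (nonzero) output state `q'`. -/
def Branch (q : Hil I) (q' : Hil O) : Prop :=
  q' ≠ 0 ∧ ∃ Γ : Outcomes V,
    Exec P.cmds ⟨Finset.univ, P.prep q, fun _ => none⟩ ⟨P.outputs, P.embedOut q', Γ⟩

/-- Any two outputs reachable from the same input differ only by a scalar. -/
def Deterministic : Prop :=
  ∀ (q : Hil I) (q' q'' : Hil O), P.Branch q q' → P.Branch q q'' → ∃ c : ℂ, q'' = c • q'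

/-- The pattern implements `U`: it is deterministic, and `U q` is, up to a global phase, the
renormalised output `(‖q‖ / ‖q'‖) q'`. -/
def Implements [DecidableEq I] [Fintype I] [DecidableEq O] (U : Hil I ≃ₗᵢ[ℂ] Hil O) : Prop :=
  P.Deterministic ∧
    ∀ q : Hil I, q ≠ 0 → ∃ q' : Hil O, P.Branch q q' ∧
      ∃ c : ℂ, ‖c‖ = 1 ∧ U q = c • (((‖q‖ / ‖q'‖ : ℝ) : ℂ) • q')

end Pattern

end Run

end OneWay

end

/-! Clifford operators have patterns because they are generated, up to nonzero scalars, by gates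
with one-ancilla patterns: the Hadamard operators `X_i + Z_i` and the phases `1 - i Z^b`, where
`Z^b` is a product of `Z`s (`mem_gateOps_of_normalizes`). The basic move is `P + Q` for
anticommuting Pauli involutions `P`, `Q`: conjugation by it exchanges `P` and `Q`. Every such sum is
a product of gates (`AntiPair.add_mem_gateOps`). Such moves carry the conjugates of `Z_i` and `X_i`
under a Clifford operator back to `Z_i` and `X_i`, one qubit at a time, until only a scalar is left.
Hadamard operators are realised by teleportation (`realizable_had`), phases by an ancilla measured
at angle `π/2` (`realizable_phase`), and patterns compose (`Realizable.mul`).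

Conversely, a branch with fixed outcomes is linear in the input. A linear map `A` is called
stabilizer when, for all Paulis `P`, `P'`, the map `P' A P` is a multiple of `A` or Hilbert–Schmidt
orthogonal to it. The preparation has this property (`isStabilizer_pullback`), and each command
preserves it: entanglements and corrections are Clifford, and an `M^x` or `M^y` bra is, up to a
scalar, a Clifford phase followed by `1 + X_i`. If the pattern implements `U`, a branch with nonzero
end is a nonzero multiple of `U`, so `U` is stabilizer. As the Paulis span all operators, `U` cannot
be orthogonal to all `Q U P` for a fixed `P`; hence some `Q U P` is a multiple of `U`, and `U`
normalises the Pauli group (`mem_cliffordGroup_of_isStabilizer`). -/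

noncomputable section

namespace OneWay

set_option linter.unusedSectionVars false

/-! ### Pauli operators: signs, irreducibility, spanning. -/

section Algebra

variable {A : Type*} [DecidableEq A] [Fintype A]

/-- The linear operators on the state space of the qubits `A`. -/
abbrev Op (A : Type*) : Type _ := Module.End ℂ (Hil A)

/-- Forget that a unitary is isometric and invertible. -/
def toOp : (Hil A ≃ₗᵢ[ℂ] Hil A) →* Op A where
  toFun U := U.toLinearEquiv.toLinearMap
  map_one' := rfl
  map_mul' _ _ := rfl

theorem toOp_apply (U : Hil A ≃ₗᵢ[ℂ] Hil A) (q : Hil A) : toOp U q = U q := rfl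

theorem toOp_injective : Function.Injective (toOp : (Hil A ≃ₗᵢ[ℂ] Hil A) →* Op A) := by
  intro U V h
  ext1 q
  exact LinearMap.congr_fun h q

/-- The operator `X_i`. -/
def opX (i : A) : Op A := toOp (pauliX i)

/-- The operator `Z_i`. -/
def opZ (i : A) : Op A := toOp (pauliZ i)

theorem opX_apply (i : A) (q : Hil A) (x : A → Fin 2) : opX i q x = q (flipBit i x) := rfl

theorem opZ_apply (i : A) (q : Hil A) (x : A → Fin 2) :
    opZ i q x = (if x i = 1 then -1 else 1) * q x := pauliZ_apply i q x

theorem op_ext {M N : Op A} (h : ∀ q x, M q x = N q x) : M = N :=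
  LinearMap.ext fun q => PiLp.ext fun x => h q x

theorem flipBit_same (i : A) (x : A → Fin 2) : flipBit i x i = x i + 1 := by simp [flipBit]

theorem flipBit_ne {i j : A} (h : j ≠ i) (x : A → Fin 2) : flipBit i x j = x j := by
  simp [flipBit, h]

theorem flipBit_comm (i j : A) (x : A → Fin 2) :
    flipBit i (flipBit j x) = flipBit j (flipBit i x) := by
  by_cases h : i = j
  · rw [h]
  · ext k
    by_cases h1 : k = i
    · subst h1; simp [flipBit, h]
    · by_cases h2 : k = j
      · subst h2; simp [flipBit, h1]
      · simp [flipBit, h1, h2]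

theorem opX_mul_self (i : A) : opX i * opX i = 1 :=
  op_ext fun q x => by
    change opX i (opX i q) x = q x
    rw [opX_apply, opX_apply, flipBit_flipBit]

theorem opZ_mul_self (i : A) : opZ i * opZ i = 1 :=
  op_ext fun q x => by
    change opZ i (opZ i q) x = q x
    rw [opZ_apply, opZ_apply]
    split_ifs <;> simp

theorem opX_comm (i j : A) : Commute (opX i) (opX j) :=
  op_ext fun q x => by
    change opX i (opX j q) x = opX j (opX i q) x
    simp only [opX_apply, flipBit_comm]

theorem opZ_comm (i j : A) : Commute (opZ i) (opZ j) :=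
  op_ext fun q x => by
    change opZ i (opZ j q) x = opZ j (opZ i q) x
    simp only [opZ_apply]
    ring

theorem opX_opZ_comm {i j : A} (h : i ≠ j) : Commute (opX i) (opZ j) :=
  op_ext fun q x => by
    change opX i (opZ j q) x = opZ j (opX i q) x
    simp only [opX_apply, opZ_apply, flipBit_ne h.symm]

theorem opX_opZ_anti (i : A) : opX i * opZ i = -(opZ i * opX i) :=
  op_ext fun q x => by
    change opX i (opZ i q) x = -(opZ i (opX i q) x)
    simp only [opX_apply, opZ_apply, flipBit_same]
    have h : x i = 0 ∨ x i = 1 := by generalize x i = b; revert b; decide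
    rcases h with h | h <;> simp [h]

/-- The Pauli operators. -/
def pauliOps (A : Type*) [DecidableEq A] [Fintype A] : Submonoid (Op A) :=
  Submonoid.closure (Set.range opX ∪ Set.range opZ ∪ {Complex.I • (1 : Op A)})

theorem opX_mem (i : A) : opX i ∈ pauliOps A :=
  Submonoid.subset_closure (Or.inl (Or.inl ⟨i, rfl⟩))

theorem opZ_mem (i : A) : opZ i ∈ pauliOps A :=
  Submonoid.subset_closure (Or.inl (Or.inr ⟨i, rfl⟩))

theorem I_smul_mem {P : Op A} (h : P ∈ pauliOps A) : Complex.I • P ∈ pauliOps A := by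
  have := (pauliOps A).mul_mem (Submonoid.subset_closure (Or.inr rfl) :
    Complex.I • (1 : Op A) ∈ pauliOps A) h
  rwa [smul_mul_assoc, one_mul] at this

theorem neg_mem_pauliOps {P : Op A} (h : P ∈ pauliOps A) : -P ∈ pauliOps A := by
  have := I_smul_mem (I_smul_mem h)
  rwa [smul_smul, Complex.I_mul_I, neg_one_smul] at this

theorem smul_mem_pauliOps {P : Op A} (h : P ∈ pauliOps A) {c : ℂ} (hc : c ^ 4 = 1) :
    c • P ∈ pauliOps A := by
  have : (c - 1) * (c + 1) * ((c - Complex.I) * (c + Complex.I)) = 0 := by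
    linear_combination hc + (1 - c ^ 2) * Complex.I_sq
  rcases mul_eq_zero.1 this with h' | h' <;> rcases mul_eq_zero.1 h' with h' | h'
  · rw [sub_eq_zero.1 h', one_smul]; exact h
  · rw [eq_neg_of_add_eq_zero_left h', neg_one_smul]; exact neg_mem_pauliOps h
  · rw [sub_eq_zero.1 h']; exact I_smul_mem h
  · rw [eq_neg_of_add_eq_zero_left h', neg_smul]; exact neg_mem_pauliOps (I_smul_mem h)

/-- Induction on a Pauli operator, one generator on the left at a time. -/
theorem pauliOps_induction {p : Op A → Prop} (one : p 1)
    (X : ∀ i P, P ∈ pauliOps A → p P → p (opX i * P))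
    (Z : ∀ i P, P ∈ pauliOps A → p P → p (opZ i * P))
    (I : ∀ P, P ∈ pauliOps A → p P → p (Complex.I • P)) {P : Op A} (hP : P ∈ pauliOps A) : p P := by
  induction hP using Submonoid.closure_induction_left with
  | one => exact one
  | mul_left g hg P hP ih =>
    rcases hg with (⟨i, rfl⟩ | ⟨i, rfl⟩) | rfl
    · exact X i P hP ih
    · exact Z i P hP ih
    · rw [smul_mul_assoc, one_mul]; exact I P hP ih

/-- Two operators commute or anticommute. -/
def SignComm {R : Type*} [Ring R] (a b : R) : Prop := a * b = b * a ∨ a * b = -(b * a)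

theorem SignComm.symm {R : Type*} [Ring R] {a b : R} (h : SignComm a b) : SignComm b a := by
  rcases h with h | h
  · exact Or.inl h.symm
  · exact Or.inr (by rw [h, neg_neg])

theorem SignComm.mul_left {R : Type*} [Ring R] {a b c : R} (ha : SignComm a c)
    (hb : SignComm b c) : SignComm (a * b) c := by
  unfold SignComm
  rw [mul_assoc, ← mul_assoc c a b]
  rcases ha with ha | ha <;> rcases hb with hb | hb <;> rw [hb] <;>
    simp [← mul_assoc, ha]

theorem SignComm.smul_left {R : Type*} [Ring R] [Algebra ℂ R] {a b : R} (h : SignComm a b)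
    (c : ℂ) : SignComm (c • a) b := by
  unfold SignComm
  rcases h with h | h <;> simp [h]

theorem pauliOps_signComm_of {c : Op A} (hX : ∀ i, SignComm (opX i) c)
    (hZ : ∀ i, SignComm (opZ i) c) {P : Op A} (hP : P ∈ pauliOps A) : SignComm P c :=
  pauliOps_induction (p := fun P => SignComm P c) (Or.inl (by simp))
    (fun i _ _ h => (hX i).mul_left h) (fun i _ _ h => (hZ i).mul_left h)
    (fun _ _ h => h.smul_left _) hP

theorem signComm_opX_opZ (i j : A) : SignComm (opX i) (opZ j) := by
  by_cases h : i = j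
  · subst h; exact Or.inr (opX_opZ_anti i)
  · exact Or.inl (opX_opZ_comm h)

theorem pauliOps_signComm {P Q : Op A} (hP : P ∈ pauliOps A) (hQ : Q ∈ pauliOps A) :
    SignComm P Q :=
  pauliOps_signComm_of
    (fun i => (pauliOps_signComm_of (fun j => Or.inl (opX_comm j i))
      (fun j => (signComm_opX_opZ i j).symm) hQ).symm)
    (fun i => (pauliOps_signComm_of (fun j => signComm_opX_opZ j i)
      (fun j => Or.inl (opZ_comm j i)) hQ).symm) hP

theorem mul_self_of_signComm {R : Type*} [Ring R] {a b : R} (ha : a * a = 1 ∨ a * a = -1)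
    (hb : b * b = 1 ∨ b * b = -1) (h : SignComm a b) :
    (a * b) * (a * b) = 1 ∨ (a * b) * (a * b) = -1 := by
  have key : (a * b) * (a * b) = (a * a) * (b * b) ∨ (a * b) * (a * b) = -((a * a) * (b * b)) := by
    rcases h.symm with h | h
    · left; rw [mul_assoc, ← mul_assoc b, h]; simp only [mul_assoc]
    · right; rw [mul_assoc, ← mul_assoc b, h]; simp only [mul_assoc, neg_mul, mul_neg]
  rcases ha with ha | ha <;> rcases hb with hb | hb <;> rw [ha, hb] at key <;> simpa [or_comm] using key

theorem pauliOps_mul_self {P : Op A} (hP : P ∈ pauliOps A) : P * P = 1 ∨ P * P = -1 := by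
  refine pauliOps_induction (p := fun P => P * P = 1 ∨ P * P = -1) (by simp)
    (fun i P hP h => ?_) (fun i P hP h => ?_) (fun P hP h => ?_) hP
  · exact mul_self_of_signComm (Or.inl (opX_mul_self i)) h (pauliOps_signComm (opX_mem i) hP)
  · exact mul_self_of_signComm (Or.inl (opZ_mul_self i)) h (pauliOps_signComm (opZ_mem i) hP)
  · rw [smul_mul_smul_comm, Complex.I_mul_I, neg_one_smul]
    rcases h with h | h <;> simp [h]

/-- The inverse is `P` or `-P`, according to the sign of `P * P`; thus the submonoid `pauliOps` is a
group. -/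
theorem exists_pauliOps_inv {P : Op A} (hP : P ∈ pauliOps A) :
    ∃ P' ∈ pauliOps A, P * P' = 1 ∧ P' * P = 1 := by
  rcases pauliOps_mul_self hP with h | h
  · exact ⟨P, hP, h, h⟩
  · exact ⟨-P, neg_mem_pauliOps hP, by simp [h], by simp [h]⟩

theorem isUnit_of_mem_pauliOps {P : Op A} (hP : P ∈ pauliOps A) : IsUnit P := by
  obtain ⟨P', -, h1, h2⟩ := exists_pauliOps_inv hP
  exact ⟨⟨P, P', h1, h2⟩, rfl⟩

/-- Flips act transitively: `x` is reached from `0` by switching on its bits over a growing set.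
Only constancy is meant, not vanishing. -/
theorem eq_zero_of_flip_invariant {f : (A → Fin 2) → ℂ}
    (h : ∀ i x, f (flipBit i x) = f x) (x : A → Fin 2) : f x = f 0 := by
  have key : ∀ s : Finset A, f (fun j => if j ∈ s then x j else 0) = f 0 := by
    intro s
    induction s using Finset.induction_on with
    | empty => simp; rfl
    | insert i s hi ih =>
      by_cases hx : x i = 0
      · rw [← ih]
        congr 1
        ext j
        by_cases hj : j = i
        · subst hj; simp [hi, hx]
        · simp [hj]
      · have hx : x i = 1 := by
          revert hx; generalize x i = b; revert b; decide
        rw [← ih, ← h i]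
        congr 1
        ext j
        by_cases hj : j = i
        · subst hj; simp [hi, hx, flipBit_same]
        · simp [hj, flipBit_ne hj]
  simpa using key Finset.univ

/-- The computational basis states. -/
abbrev basisKet (y : A → Fin 2) : Hil A := EuclideanSpace.single y 1

theorem op_ext_basis {B : Type*} {M N : Hil A →ₗ[ℂ] Hil B}
    (h : ∀ y, M (basisKet y) = N (basisKet y)) : M = N := by
  refine (EuclideanSpace.basisFun (A → Fin 2) ℂ).toBasis.ext fun y => ?_
  simpa using h y

theorem opX_basisKet (i : A) (y : A → Fin 2) : opX i (basisKet y) = basisKet (flipBit i y) := by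
  ext x
  rw [opX_apply]
  have : flipBit i x = y ↔ x = flipBit i y :=
    ⟨fun h => by rw [← h, flipBit_flipBit], fun h => by rw [h, flipBit_flipBit]⟩
  simp [this]

theorem opZ_basisKet (i : A) (y : A → Fin 2) :
    opZ i (basisKet y) = (if y i = 1 then -1 else 1 : ℂ) • basisKet y := by
  ext x
  rw [opZ_apply]
  change _ = (if y i = 1 then -1 else 1 : ℂ) * basisKet y x
  by_cases h : x = y
  · rw [h]
  · simp [h]

/-- The Pauli operators act irreducibly. -/
theorem exists_eq_smul_one {N : Op A} (hX : ∀ i, Commute N (opX i))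
    (hZ : ∀ i, Commute N (opZ i)) : ∃ c : ℂ, N = c • (1 : Op A) := by
  -- Commuting with all `Z_i` makes `N` diagonal, since distinct basis states have different signs
  -- under some `Z_i`.
  have hd : ∀ x y : A → Fin 2, x ≠ y → N (basisKet y) x = 0 := by
    intro x y hxy
    obtain ⟨i, hi⟩ := Function.ne_iff.1 hxy
    have := congrArg (fun q : Hil A => q x) (LinearMap.congr_fun (hZ i) (basisKet y))
    change N (opZ i (basisKet y)) x = opZ i (N (basisKet y)) x at this
    rw [opZ_basisKet, opZ_apply, map_smul] at this
    change (if y i = 1 then -1 else 1 : ℂ) * N (basisKet y) x = _ at this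
    have h01 : ∀ b : Fin 2, b = 0 ∨ b = 1 := by decide
    rcases h01 (x i) with h1 | h1 <;> rcases h01 (y i) with h2 | h2 <;> rw [h1, h2] at this hi
    · exact absurd rfl hi
    · simp at this; linear_combination -this / 2
    · simp at this; linear_combination this / 2
    · exact absurd rfl hi
  -- Commuting with all `X_i` makes the diagonal invariant under flips, hence constant.
  have hc := eq_zero_of_flip_invariant (f := fun y => N (basisKet y) y) (by
    intro i y
    have := congrArg (fun q : Hil A => q (flipBit i y)) (LinearMap.congr_fun (hX i) (basisKet y))
    change N (opX i (basisKet y)) (flipBit i y) = opX i (N (basisKet y)) (flipBit i y) at this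
    rwa [opX_basisKet, opX_apply, flipBit_flipBit] at this)
  refine ⟨N (basisKet 0) 0, op_ext_basis fun y => ?_⟩
  ext x
  by_cases h : x = y
  · subst h
    simpa using hc x
  · rw [hd x y h]
    simp [h]

/-- The Pauli operators span all operators. -/
theorem mem_span_pauliOps (N : Op A) : N ∈ Submodule.span ℂ (pauliOps A : Set (Op A)) := by
  have hmul : ∀ M P : Op A, P ∈ pauliOps A →
      M ∈ Submodule.span ℂ (pauliOps A : Set (Op A)) →
      M * P ∈ Submodule.span ℂ (pauliOps A : Set (Op A)) := by
    intro M P hP hM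
    induction hM using Submodule.span_induction with
    | mem M hM => exact Submodule.subset_span ((pauliOps A).mul_mem hM hP)
    | zero => simp
    | add M N _ _ h1 h2 => rw [add_mul]; exact add_mem h1 h2
    | smul c M _ h => rw [smul_mul_assoc]; exact Submodule.smul_mem _ _ h
  -- Induction on the qubits where `N` may act nontrivially; irreducibility is the base case.
  have key : ∀ S : Finset A, ∀ N : Op A, (∀ j ∉ S, Commute N (opX j) ∧ Commute N (opZ j)) →
      N ∈ Submodule.span ℂ (pauliOps A : Set (Op A)) := by
    intro S
    induction S using Finset.induction_on with
    | empty =>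
      intro N h
      obtain ⟨c, rfl⟩ := exists_eq_smul_one (fun i => (h i (by simp)).1) (fun i => (h i (by simp)).2)
      exact Submodule.smul_mem _ _ (Submodule.subset_span (pauliOps A).one_mem)
    | insert i S hi ih =>
      -- `N` splits into a part commuting and a part anticommuting with the involution `G`, namely
      -- `(N ± G N G) / 2`. What commutes with `N`, and with `G` up to sign, commutes with both
      -- parts.
      have half : ∀ N G : Op A, G * G = 1 → ∃ N₀ N₁ : Op A, N = N₀ + N₁ ∧
          Commute N₀ G ∧ N₁ * G = -(G * N₁) ∧
          ∀ K, Commute N K → SignComm K G → Commute N₀ K ∧ Commute N₁ K := by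
        intro N G hG
        refine ⟨(1 / 2 : ℂ) • (N + G * N * G), (1 / 2 : ℂ) • (N - G * N * G), ?_, ?_, ?_, ?_⟩
        · rw [← smul_add, add_add_sub_cancel, ← two_smul ℂ, smul_smul]; norm_num
        · refine Commute.smul_left ?_ _
          have h1 : G * N * G * G = G * N := by rw [mul_assoc _ G, hG, mul_one]
          have h2 : G * (G * N * G) = N * G := by rw [← mul_assoc, ← mul_assoc, hG, one_mul]
          change (N + G * N * G) * G = G * (N + G * N * G)
          rw [add_mul, mul_add, h1, h2, add_comm]
        · have h1 : G * N * G * G = G * N := by rw [mul_assoc _ G, hG, mul_one]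
          have h2 : G * (G * N * G) = N * G := by rw [← mul_assoc, ← mul_assoc, hG, one_mul]
          rw [smul_mul_assoc, mul_smul_comm, sub_mul, mul_sub, h1, h2, ← smul_neg, neg_sub]
        · intro K hN hK
          have h : Commute (G * N * G) K := by
            change G * N * G * K = K * (G * N * G)
            have hN' : N * K = K * N := hN
            rcases hK.symm with h | h
            · rw [mul_assoc, h, ← mul_assoc, mul_assoc G N, hN', ← mul_assoc, h]
              simp only [mul_assoc]
            · rw [mul_assoc, h, mul_neg, ← mul_assoc, mul_assoc G N, hN', ← mul_assoc, h]
              simp only [mul_assoc, neg_mul, neg_neg]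
          exact ⟨(hN.add_left h).smul_left _, (hN.sub_left h).smul_left _⟩
      have fix : ∀ N G H : Op A, N * G = -(G * N) → H * G = -(G * H) → Commute (N * H) G := by
        intro N G H h1 h2
        change N * H * G = G * (N * H)
        rw [mul_assoc, h2, mul_neg, ← mul_assoc, h1, neg_mul, neg_neg, mul_assoc]
      have back : ∀ N P : Op A, P ∈ pauliOps A → P * P = 1 →
          N * P ∈ Submodule.span ℂ (pauliOps A : Set (Op A)) →
          N ∈ Submodule.span ℂ (pauliOps A : Set (Op A)) := by
        intro N P hP h1 h2
        have := hmul _ P hP h2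
        rwa [mul_assoc, h1, mul_one] at this
      -- Split along `Z_i`. The anticommuting part becomes trivial at `i` after multiplication by
      -- `X_i`, which `back` undoes.
      have step : ∀ N : Op A, Commute N (opX i) →
          (∀ j ∉ insert i S, Commute N (opX j) ∧ Commute N (opZ j)) →
          N ∈ Submodule.span ℂ (pauliOps A : Set (Op A)) := by
        intro N hX hN
        obtain ⟨a, b, rfl, ha, hb, hK⟩ := half N (opZ i) (opZ_mul_self i)
        have hXi := hK _ hX (signComm_opX_opZ i i)
        refine add_mem (ih a fun j hj => ?_) (back b (opX i) (opX_mem i) (opX_mul_self i)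
          (ih _ fun j hj => ?_))
        · by_cases h : j = i
          · subst h; exact ⟨hXi.1, ha⟩
          · have hj' : j ∉ insert i S := by simp [h, hj]
            exact ⟨(hK _ (hN j hj').1 (signComm_opX_opZ j i)).1,
              (hK _ (hN j hj').2 (Or.inl (opZ_comm j i))).1⟩
        · by_cases h : j = i
          · subst h; exact ⟨hXi.2.mul_left (Commute.refl _), fix _ _ _ hb (opX_opZ_anti j)⟩
          · have hj' : j ∉ insert i S := by simp [h, hj]
            exact ⟨(hK _ (hN j hj').1 (signComm_opX_opZ j i)).2.mul_left (opX_comm i j),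
              (hK _ (hN j hj').2 (Or.inl (opZ_comm j i))).2.mul_left (opX_opZ_comm (Ne.symm h))⟩
      intro N hN
      -- Splitting along `X_i` reduces to `step`; here `Z_i` repairs the anticommuting part.
      obtain ⟨a, b, rfl, ha, hb, hK⟩ := half N (opX i) (opX_mul_self i)
      refine add_mem (step a ha fun j hj => ?_) (back b (opZ i) (opZ_mem i) (opZ_mul_self i)
          (step _ (fix _ _ _ hb ?_) fun j hj => ?_))
      · exact ⟨(hK _ (hN j hj).1 (Or.inl (opX_comm j i))).1,
          (hK _ (hN j hj).2 (signComm_opX_opZ i j).symm).1⟩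
      · rw [opX_opZ_anti, neg_neg]
      · have hji : i ≠ j := fun h => hj (by simp [h])
        exact ⟨(hK _ (hN j hj).1 (Or.inl (opX_comm j i))).2.mul_left (opX_opZ_comm hji.symm).symm,
          (hK _ (hN j hj).2 (signComm_opX_opZ i j).symm).2.mul_left (opZ_comm i j)⟩
  exact key Finset.univ N (by simp)

end Algebra

/-! ### The gates, and sums of anticommuting Paulis as products of gates. -/

section Generation

variable {A : Type*} [DecidableEq A] [Fintype A]

/-- The sign `(-1)^{∑_{i ∈ b} x_i}`. -/
def parity (b : Finset A) (x : A → Fin 2) : ℂ := ∏ i ∈ b, if x i = 1 then -1 else 1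

theorem parity_sq (b : Finset A) (x : A → Fin 2) : parity b x * parity b x = 1 := by
  rw [parity, ← Finset.prod_mul_distrib]
  exact Finset.prod_eq_one fun i _ => by split_ifs <;> simp

/-- The product of the `Z_i`, `i ∈ b`. -/
def opZs (b : Finset A) : Op A where
  toFun q := WithLp.toLp 2 fun x => parity b x * q x
  map_add' p q := by ext x; exact mul_add _ _ _
  map_smul' c q := by ext x; exact mul_left_comm _ _ _

theorem opZs_apply (b : Finset A) (q : Hil A) (x : A → Fin 2) :
    opZs b q x = parity b x * q x := rfl

theorem opZs_empty : opZs (∅ : Finset A) = 1 :=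
  op_ext fun q x => by
    change parity ∅ x * q x = q x
    simp [parity]

theorem opZ_mul_opZs {i : A} {b : Finset A} (h : i ∉ b) : opZ i * opZs b = opZs (insert i b) :=
  op_ext fun q x => by
    change opZ i (opZs b q) x = opZs (insert i b) q x
    rw [opZ_apply, opZs_apply, opZs_apply, parity, parity, Finset.prod_insert h, mul_assoc]

theorem exists_opZ_mul_opZs (i : A) (b : Finset A) : ∃ b', opZ i * opZs b = opZs b' := by
  by_cases h : i ∈ b
  · refine ⟨b.erase i, ?_⟩
    rw [← Finset.insert_erase h, ← opZ_mul_opZs (Finset.notMem_erase i b), ← mul_assoc,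
      opZ_mul_self, one_mul, Finset.insert_erase h]
  · exact ⟨_, opZ_mul_opZs h⟩

theorem opZs_mem (b : Finset A) : opZs b ∈ pauliOps A := by
  induction b using Finset.induction_on with
  | empty => rw [opZs_empty]; exact one_mem _
  | insert i b hi ih => rw [← opZ_mul_opZs hi]; exact mul_mem (opZ_mem i) ih

theorem opZs_singleton (i : A) : opZs {i} = opZ i := by
  rw [← insert_empty_eq, ← opZ_mul_opZs (Finset.notMem_empty i), opZs_empty, mul_one]

theorem opZs_mul_self (b : Finset A) : opZs b * opZs b = 1 :=
  op_ext fun q x => by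
    change opZs b (opZs b q) x = q x
    rw [opZs_apply, opZs_apply, ← mul_assoc, parity_sq, one_mul]

/-- Flip the bits at which `a` is `1`. -/
def opXs (a : A → Fin 2) : Op A where
  toFun q := WithLp.toLp 2 fun x => q (x + a)
  map_add' _ _ := rfl
  map_smul' _ _ := rfl

theorem opXs_zero : opXs (0 : A → Fin 2) = 1 :=
  op_ext fun q x => by
    change q (x + 0) = q x
    rw [add_zero]

theorem flipBit_eq (i : A) (x : A → Fin 2) : flipBit i x = x + Pi.single i 1 := by
  ext j
  by_cases h : j = i
  · subst h; simp [flipBit]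
  · simp [flipBit, h]

theorem opX_mul_opXs (i : A) (a : A → Fin 2) : opX i * opXs a = opXs (a + Pi.single i 1) :=
  op_ext fun q x => by
    change q (flipBit i x + a) = q (x + (a + Pi.single i 1))
    rw [flipBit_eq, add_assoc, add_comm a]

theorem pauliOps_normalForm {P : Op A} (hP : P ∈ pauliOps A) :
    ∃ (c : ℂ) (b : Finset A) (a : A → Fin 2), P = c • (opZs b * opXs a) := by
  refine pauliOps_induction (p := fun P => ∃ (c : ℂ) (b : Finset A) (a : A → Fin 2),
    P = c • (opZs b * opXs a)) ⟨1, ∅, 0, by rw [opZs_empty, opXs_zero, mul_one, one_smul]⟩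
    ?_ ?_ ?_ hP
  · rintro i - - ⟨c, b, a, rfl⟩
    rcases pauliOps_signComm (opX_mem i) (opZs_mem b) with h | h
    · exact ⟨c, b, _, by rw [← opX_mul_opXs, mul_smul_comm, ← mul_assoc, h, mul_assoc]⟩
    · exact ⟨-c, b, _, by
        rw [← opX_mul_opXs, mul_smul_comm, ← mul_assoc, h, neg_mul, smul_neg, neg_smul, mul_assoc]⟩
  · rintro i - - ⟨c, b, a, rfl⟩
    obtain ⟨b', hb⟩ := exists_opZ_mul_opZs i b
    exact ⟨c, b', a, by rw [← hb, mul_smul_comm, mul_assoc]⟩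
  · rintro - - ⟨c, b, a, rfl⟩
    exact ⟨Complex.I * c, b, a, by rw [smul_smul]⟩

theorem opXs_opZ_anti {a : A → Fin 2} {i : A} (h : a i = 1) :
    opXs a * opZ i = -(opZ i * opXs a) :=
  op_ext fun q x => by
    change opZ i q (x + a) = -(opZ i (opXs a q) x)
    rw [opZ_apply, opZ_apply]
    change _ = -(_ * q (x + a))
    have h01 : ∀ b : Fin 2, b = 0 ∨ b = 1 := by decide
    rcases h01 (x i) with h' | h' <;> simp [h, h']

/-- In the normal form, a bit `a i = 1` makes `P` anticommute with `Z_i`; as they also commute, `P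
Z_i` would vanish although it is invertible. -/
theorem eq_smul_opZs {P : Op A} (hP : P ∈ pauliOps A) (h : ∀ i, Commute P (opZ i)) :
    ∃ (c : ℂ) (b : Finset A), P = c • opZs b := by
  obtain ⟨c, b, a, rfl⟩ := pauliOps_normalForm hP
  suffices a = 0 by
    subst this
    exact ⟨c, b, by rw [opXs_zero, mul_one]⟩
  ext1 i
  by_contra hi
  have hi : a i = 1 := by
    change ¬ a i = 0 at hi
    revert hi; generalize a i = b; revert b; decide
  have hz : opZ i * opZs b = opZs b * opZ i :=
    op_ext fun q x => by
      change opZ i (opZs b q) x = opZs b (opZ i q) x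
      simp only [opZ_apply, opZs_apply]
      ring
  set P := c • (opZs b * opXs a) with hPdef
  have h1 : P * opZ i = -(opZ i * P) := by
    rw [hPdef, smul_mul_assoc, mul_smul_comm, mul_assoc, opXs_opZ_anti hi, mul_neg, ← mul_assoc,
      ← mul_assoc, hz, smul_neg]
  rw [← (h i).eq] at h1
  have h2 : (2 : ℂ) • (P * opZ i) = 0 := by
    rw [two_smul]; nth_rewrite 1 [h1]; simp
  have h3 := (smul_eq_zero.1 h2).resolve_left two_ne_zero
  exact (isUnit_of_mem_pauliOps (mul_mem hP (opZ_mem i))).ne_zero h3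

/-- Conjugation by `u` maps Pauli operators to Pauli operators. -/
def Normalizes (u : Op A) : Prop := ∀ P ∈ pauliOps A, ∃ P' ∈ pauliOps A, u * P = P' * u

theorem Normalizes.mul {u v : Op A} (hu : Normalizes u) (hv : Normalizes v) :
    Normalizes (u * v) := by
  intro P hP
  obtain ⟨P', hP', h'⟩ := hv P hP
  obtain ⟨P'', hP'', h''⟩ := hu P' hP'
  exact ⟨P'', hP'', by rw [mul_assoc, h', ← mul_assoc, h'', mul_assoc]⟩

theorem normalizes_of_mem {u : Op A} (hu : u ∈ pauliOps A) : Normalizes u := by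
  intro P hP
  rcases pauliOps_signComm hu hP with h | h
  · exact ⟨P, hP, h⟩
  · exact ⟨-P, neg_mem_pauliOps hP, by rw [h, neg_mul]⟩

/-- Anticommuting Pauli operators of square `1`. -/
structure AntiPair (P Q : Op A) : Prop where
  left_mem : P ∈ pauliOps A
  right_mem : Q ∈ pauliOps A
  left_sq : P * P = 1
  right_sq : Q * Q = 1
  anti : P * Q = -(Q * P)

namespace AntiPair

variable {P Q : Op A} (h : AntiPair P Q)
include h

theorem symm : AntiPair Q P :=
  ⟨h.right_mem, h.left_mem, h.right_sq, h.left_sq, by rw [h.anti, neg_neg]⟩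

theorem add_mul_self : (P + Q) * (P + Q) = (2 : ℂ) • (1 : Op A) := by
  rw [add_mul, mul_add, mul_add, h.left_sq, h.right_sq, h.anti, two_smul]
  abel

/-- Conjugation by `P + Q` exchanges `P` and `Q`, as the Hadamard operator exchanges `X` and `Z`. -/
theorem add_mul_left : (P + Q) * P = Q * (P + Q) := by
  rw [add_mul, mul_add, h.left_sq, h.right_sq, add_comm]

theorem add_mul_right : (P + Q) * Q = P * (P + Q) := by
  rw [add_mul, mul_add, h.left_sq, h.right_sq, add_comm]

/-- Undoes a factor `P + Q` using only `P + Q` itself, so that no inverses are needed in the monoid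
`gateOps`. -/
theorem eq_half_mul (M : Op A) : M = (1 / 2 : ℂ) • ((P + Q) * ((P + Q) * M)) := by
  rw [← mul_assoc, h.add_mul_self, smul_mul_assoc, one_mul, smul_smul]
  norm_num

theorem isUnit_add : IsUnit (P + Q) := by
  have h1 : (P + Q) * ((1 / 2 : ℂ) • (P + Q)) = 1 := by
    rw [mul_smul_comm, h.add_mul_self, smul_smul]; norm_num
  have h2 : ((1 / 2 : ℂ) • (P + Q)) * (P + Q) = 1 := by
    rw [smul_mul_assoc, h.add_mul_self, smul_smul]; norm_num
  exact ⟨⟨_, _, h1, h2⟩, rfl⟩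

/-- Both `(P + Q) R` and `R P Q (P + Q)` equal `R (P - Q)`. -/
theorem normalizes_of_mixed {R : Op A} (hR : R ∈ pauliOps A) (hP : P * R = R * P)
    (hQ : Q * R = -(R * Q)) : ∃ R' ∈ pauliOps A, (P + Q) * R = R' * (P + Q) := by
  refine ⟨R * P * Q, mul_mem (mul_mem hR h.left_mem) h.right_mem, ?_⟩
  rw [add_mul, mul_add, hP, hQ, mul_assoc (R * P) Q Q, h.right_sq, mul_one, mul_assoc R P Q, h.anti,
    mul_neg, neg_mul, mul_assoc R, mul_assoc Q, h.left_sq, mul_one, add_comm]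

theorem normalizes : Normalizes (P + Q) := by
  intro R hR
  rcases pauliOps_signComm h.left_mem hR with h1 | h1 <;>
    rcases pauliOps_signComm h.right_mem hR with h2 | h2
  · exact ⟨R, hR, by rw [add_mul, mul_add, h1, h2]⟩
  · exact h.normalizes_of_mixed hR h1 h2
  · rw [add_comm]; exact h.symm.normalizes_of_mixed hR h2 h1
  · exact ⟨-R, neg_mem_pauliOps hR, by rw [add_mul, h1, h2, neg_mul, mul_add, neg_add]⟩

end AntiPair

theorem antiPair_opX_opZ (i : A) : AntiPair (opX i) (opZ i) :=
  ⟨opX_mem i, opZ_mem i, opX_mul_self i, opZ_mul_self i, opX_opZ_anti i⟩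

/-- The operator `Y_i`. -/
def opY (i : A) : Op A := Complex.I • (opX i * opZ i)

theorem opY_mem (i : A) : opY i ∈ pauliOps A := I_smul_mem (mul_mem (opX_mem i) (opZ_mem i))

theorem opX_opY_anti (i : A) : opX i * opY i = -(opY i * opX i) := by
  rw [opY, mul_smul_comm, smul_mul_assoc, mul_assoc, ← smul_neg, ← mul_neg, opX_opZ_anti]

theorem opZ_opY_anti (i : A) : opZ i * opY i = -(opY i * opZ i) := by
  rw [opY, mul_smul_comm, smul_mul_assoc, ← mul_assoc, opX_opZ_anti, neg_mul, smul_neg, neg_neg]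

theorem opY_mul_self (i : A) : opY i * opY i = 1 := by
  rw [opY, smul_mul_smul_comm, Complex.I_mul_I, opX_opZ_anti, neg_mul_neg, mul_assoc,
    ← mul_assoc (opX i), opX_opZ_anti, neg_mul, mul_assoc, opX_mul_self, mul_one, mul_neg,
    opZ_mul_self, neg_one_smul, neg_neg]

theorem antiPair_opX_opY (i : A) : AntiPair (opX i) (opY i) :=
  ⟨opX_mem i, opY_mem i, opX_mul_self i, opY_mul_self i, opX_opY_anti i⟩

/-- A Pauli operator that anticommutes with both `X_i` and `Z_i` commutes with `Y_i`. -/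
theorem commute_opY_of_anti {i : A} {P : Op A} (hX : P * opX i = -(opX i * P))
    (hZ : P * opZ i = -(opZ i * P)) : Commute P (opY i) := by
  refine Commute.smul_right ?_ _
  change P * (opX i * opZ i) = opX i * opZ i * P
  rw [← mul_assoc, hX, neg_mul, mul_assoc, hZ, mul_neg, neg_neg, mul_assoc]

/-- The operators generated, up to nonzero scalars, by the Hadamard operators and the
`exp(-iπ/4 Z^b)`. -/
def gateOps (A : Type*) [DecidableEq A] [Fintype A] : Submonoid (Op A) :=
  Submonoid.closure ({M | ∃ c : ℂ, c ≠ 0 ∧ M = c • (1 : Op A)} ∪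
    Set.range (fun b : Finset A => 1 - Complex.I • opZs b) ∪
    Set.range fun i : A => opX i + opZ i)

theorem had_mem (i : A) : opX i + opZ i ∈ gateOps A := Submonoid.subset_closure (Or.inr ⟨i, rfl⟩)

theorem phase_mem (b : Finset A) : 1 - Complex.I • opZs b ∈ gateOps A :=
  Submonoid.subset_closure (Or.inl (Or.inr ⟨b, rfl⟩))

theorem smul_mem_gateOps {c : ℂ} (hc : c ≠ 0) {M : Op A} (hM : M ∈ gateOps A) :
    c • M ∈ gateOps A := by
  have := mul_mem (Submonoid.subset_closure (Or.inl (Or.inl ⟨c, hc, rfl⟩)) :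
    c • (1 : Op A) ∈ gateOps A) hM
  rwa [smul_mul_assoc, one_mul] at this

/-- The square of `1 - i Z^b` is `-2i Z^b`. -/
theorem opZs_mem_gateOps (b : Finset A) : opZs b ∈ gateOps A := by
  have h : opZs b = (Complex.I / 2) • ((1 - Complex.I • opZs b) * (1 - Complex.I • opZs b)) := by
    simp only [sub_mul, mul_sub, one_mul, mul_one, smul_mul_smul_comm, opZs_mul_self,
      Complex.I_mul_I]
    match_scalars
    · linear_combination Complex.I_mul_I
    · ring
  rw [h]
  exact smul_mem_gateOps (by simp) (mul_mem (phase_mem b) (phase_mem b))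

theorem opZ_mem_gateOps (i : A) : opZ i ∈ gateOps A := opZs_singleton i ▸ opZs_mem_gateOps {i}

theorem opX_mem_gateOps (i : A) : opX i ∈ gateOps A := by
  rw [(antiPair_opX_opZ i).eq_half_mul (opX i), (antiPair_opX_opZ i).add_mul_left]
  exact smul_mem_gateOps (by norm_num) (mul_mem (had_mem i) (mul_mem (opZ_mem_gateOps i) (had_mem i)))

theorem pauliOps_le_gateOps {P : Op A} (hP : P ∈ pauliOps A) : P ∈ gateOps A :=
  pauliOps_induction (p := fun P => P ∈ gateOps A) (one_mem _)
    (fun i _ _ h => mul_mem (opX_mem_gateOps i) h) (fun i _ _ h => mul_mem (opZ_mem_gateOps i) h)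
    (fun _ _ h => smul_mem_gateOps Complex.I_ne_zero h) hP

theorem one_add_I_smul_opZs_mem (b : Finset A) : 1 + Complex.I • opZs b ∈ gateOps A := by
  have h : 1 + Complex.I • opZs b = Complex.I • (opZs b * (1 - Complex.I • opZs b)) := by
    rw [mul_sub, mul_one, mul_smul_comm, opZs_mul_self, smul_sub, smul_smul, Complex.I_mul_I]
    module
  rw [h]
  exact smul_mem_gateOps Complex.I_ne_zero (mul_mem (opZs_mem_gateOps b) (phase_mem b))

theorem opX_add_opY_mem (i : A) : opX i + opY i ∈ gateOps A := by
  have h : opX i + opY i = opX i * (1 + Complex.I • opZs {i}) := by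
    rw [opZs_singleton, mul_add, mul_one, mul_smul_comm, opY]
  rw [h]
  exact mul_mem (opX_mem_gateOps i) (one_add_I_smul_opZs_mem _)

theorem commute_of_intertwine {w T T' K K' : Op A} (hw : IsUnit w) (hT : w * T = T' * w)
    (hK : w * K = K' * w) (h : Commute T K) : Commute T' K' := by
  refine hw.mul_right_cancel ?_
  rw [mul_assoc, ← hK, ← mul_assoc, ← hT, mul_assoc, h.eq, ← mul_assoc, hK, mul_assoc, hT,
    mul_assoc]

/-- Up to the factor `1/2`, `1 + T` is `(P + Q) (1 + T') (P + Q)`: the question for `T` passes to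
its conjugate `T'`. -/
theorem one_add_mem_of_intertwine {P Q T T' : Op A} (h : AntiPair P Q) (hg : P + Q ∈ gateOps A)
    (hT : (P + Q) * T = T' * (P + Q)) (h' : 1 + T' ∈ gateOps A) : 1 + T ∈ gateOps A := by
  rw [h.eq_half_mul (1 + T), mul_add, mul_one, hT, ← one_add_mul]
  exact smul_mem_gateOps (by norm_num) (mul_mem hg (mul_mem h' hg))

theorem mul_self_eq_of_intertwine {w T T' : Op A} (hw : IsUnit w) (hT : w * T = T' * w)
    {c : ℂ} (h : T * T = c • (1 : Op A)) : T' * T' = c • (1 : Op A) := by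
  refine hw.mul_right_cancel ?_
  rw [mul_assoc, ← hT, ← mul_assoc, ← hT, mul_assoc, h, mul_smul_comm, smul_mul_assoc, one_mul,
    mul_one]

-- Induction on the number of qubits where `T` fails to commute with `Z_i`, that is, acts as `X` or
-- `Y`. Conjugation by `X_i + Y_i` turns a `Y` into an `X`, and conjugation by `X_i + Z_i` an `X`
-- into a `Z`. With none left, `T = ±i Z^b`, since `T * T = -1`.
open Classical in
theorem one_add_mem_gateOps_aux (n : ℕ) : ∀ T ∈ pauliOps A, T * T = (-1 : ℂ) • (1 : Op A) →
    (Finset.univ.filter fun i => ¬ Commute T (opZ i)).card ≤ n → 1 + T ∈ gateOps A := by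
  induction n with
  | zero =>
    intro T hT hT2 hc
    rw [Nat.le_zero, Finset.card_eq_zero, Finset.filter_eq_empty_iff] at hc
    obtain ⟨c, b, rfl⟩ := eq_smul_opZs hT (fun i => not_not.1 (hc (Finset.mem_univ i)))
    rw [smul_mul_smul_comm, opZs_mul_self] at hT2
    have h1 : c * c = -1 := smul_left_injective ℂ (one_ne_zero (α := Op A)) hT2
    have h2 : (c - Complex.I) * (c + Complex.I) = 0 := by
      linear_combination h1 - Complex.I_mul_I
    rcases mul_eq_zero.1 h2 with h | h
    · rw [sub_eq_zero.1 h]; exact one_add_I_smul_opZs_mem b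
    · rw [eq_neg_of_add_eq_zero_left h, neg_smul, ← sub_eq_add_neg]; exact phase_mem b
  | succ n ih =>
    -- `T` acts as `X` at `i`. Conjugation by `X_i + Z_i` makes it commute with `Z_i`, and spoils no
    -- other qubit because `X_i + Z_i` commutes with the other `Z_j`.
    have stepX : ∀ i, ∀ T ∈ pauliOps A, T * T = (-1 : ℂ) • (1 : Op A) →
        (Finset.univ.filter fun i => ¬ Commute T (opZ i)).card ≤ n + 1 →
        ¬ Commute T (opZ i) → Commute T (opX i) → 1 + T ∈ gateOps A := by
      intro i T hT hT2 hc hZ hX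
      have hp := antiPair_opX_opZ i
      obtain ⟨T', hT', h⟩ := hp.normalizes T hT
      refine one_add_mem_of_intertwine hp (had_mem i) h (ih T' hT'
        (mul_self_eq_of_intertwine hp.isUnit_add h hT2) ?_)
      refine Nat.le_of_lt_succ (lt_of_lt_of_le (Finset.card_lt_card ?_) hc)
      have hi : Commute T' (opZ i) := commute_of_intertwine hp.isUnit_add h hp.add_mul_left hX
      rw [Finset.ssubset_iff_of_subset]
      · exact ⟨i, by simpa using hZ, by simpa using hi⟩
      · intro j hj
        simp only [Finset.mem_filter, Finset.mem_univ, true_and] at hj ⊢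
        intro hj'
        by_cases hji : j = i
        · subst hji; exact hj hi
        · refine hj (commute_of_intertwine hp.isUnit_add h (K := opZ j) ?_ hj')
          exact ((opX_opZ_comm (Ne.symm hji)).add_left (opZ_comm i j)).eq
    intro T hT hT2 hc
    by_cases hlt : (Finset.univ.filter fun i => ¬ Commute T (opZ i)).card ≤ n
    · exact ih T hT hT2 hlt
    obtain ⟨i, hi⟩ := Finset.card_pos.1 (by omega :
      0 < (Finset.univ.filter fun i => ¬ Commute T (opZ i)).card)
    simp only [Finset.mem_filter, Finset.mem_univ, true_and] at hi
    rcases pauliOps_signComm hT (opX_mem i) with hX | hX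
    · exact stepX i T hT hT2 hc hi hX
    have hZ := (pauliOps_signComm hT (opZ_mem i)).resolve_left hi
    have hY := commute_opY_of_anti hX hZ
    -- `T` acts as `Y` at `i`; the move `X_i + Y_i` makes it commute with `X_i`.
    have hp := antiPair_opX_opY i
    obtain ⟨T', hT', h⟩ := hp.normalizes T hT
    have hX' : Commute T' (opX i) := commute_of_intertwine hp.isUnit_add h hp.add_mul_right hY
    have hsub : (Finset.univ.filter fun i => ¬ Commute T' (opZ i)) ⊆
        Finset.univ.filter fun i => ¬ Commute T (opZ i) := by
      intro j hj
      simp only [Finset.mem_filter, Finset.mem_univ, true_and] at hj ⊢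
      intro hj'
      by_cases hji : j = i
      · subst hji; exact hi hj'
      · refine hj (commute_of_intertwine hp.isUnit_add h (K := opZ j) ?_ hj')
        have h1 := opX_opZ_comm (Ne.symm hji)
        exact (h1.add_left ((h1.mul_left (opZ_comm i j)).smul_left _)).eq
    have hT2' := mul_self_eq_of_intertwine hp.isUnit_add h hT2
    refine one_add_mem_of_intertwine hp (opX_add_opY_mem i) h ?_
    -- If `T'` commutes with `Z_i`, the count has already dropped; otherwise `stepX` applies to
    -- `T'`.
    by_cases hi' : Commute T' (opZ i)
    · refine ih T' hT' hT2' (Nat.le_of_lt_succ (lt_of_lt_of_le (Finset.card_lt_card ?_) hc))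
      rw [Finset.ssubset_iff_of_subset hsub]
      exact ⟨i, by simpa using hi, by simpa using hi'⟩
    · exact stepX i T' hT' hT2' ((Finset.card_le_card hsub).trans hc) hi' hX'

/-- `P + Q = P (1 + P Q)`, and anticommutation gives `(P Q)² = -1`. -/
theorem AntiPair.add_mem_gateOps {P Q : Op A} (h : AntiPair P Q) : P + Q ∈ gateOps A := by
  have h1 : P + Q = P * (1 + P * Q) := by
    rw [mul_add, mul_one, ← mul_assoc, h.left_sq, one_mul]
  rw [h1]
  refine mul_mem (pauliOps_le_gateOps h.left_mem)
    (one_add_mem_gateOps_aux _ _ (mul_mem h.left_mem h.right_mem) ?_ le_rfl)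
  rw [mul_assoc, ← mul_assoc Q, h.symm.anti, neg_mul, mul_assoc P, h.right_sq,
    mul_one, mul_neg, h.left_sq, neg_one_smul]

end Generation

/-! ### Reduction of a Clifford operator to a scalar, qubit by qubit. -/

section Elimination

variable {A : Type*} [DecidableEq A] [Fintype A]

/-- The operator acts trivially on the qubits outside `S`. -/
def SupportedOn (S : Finset A) (N : Op A) : Prop :=
  ∀ j ∉ S, Commute N (opX j) ∧ Commute N (opZ j)

theorem SupportedOn.mul {S : Finset A} {M N : Op A} (hM : SupportedOn S M)
    (hN : SupportedOn S N) : SupportedOn S (M * N) :=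
  fun j hj => ⟨(hM j hj).1.mul_left (hN j hj).1, (hM j hj).2.mul_left (hN j hj).2⟩

theorem SupportedOn.add {S : Finset A} {M N : Op A} (hM : SupportedOn S M)
    (hN : SupportedOn S N) : SupportedOn S (M + N) :=
  fun j hj => ⟨(hM j hj).1.add_left (hN j hj).1, (hM j hj).2.add_left (hN j hj).2⟩

theorem SupportedOn.smul {S : Finset A} {N : Op A} (hN : SupportedOn S N) (c : ℂ) :
    SupportedOn S (c • N) :=
  fun j hj => ⟨(hN j hj).1.smul_left c, (hN j hj).2.smul_left c⟩

theorem supportedOn_opX {S : Finset A} {i : A} (hi : i ∈ S) : SupportedOn S (opX i) :=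
  fun j hj => ⟨opX_comm i j, opX_opZ_comm (by rintro rfl; exact hj hi)⟩

theorem supportedOn_opZ {S : Finset A} {i : A} (hi : i ∈ S) : SupportedOn S (opZ i) :=
  fun j hj => ⟨(opX_opZ_comm (by rintro rfl; exact hj hi)).symm, opZ_comm i j⟩

theorem supportedOn_opY {S : Finset A} {i : A} (hi : i ∈ S) : SupportedOn S (opY i) :=
  ((supportedOn_opX hi).mul (supportedOn_opZ hi)).smul _

theorem anti_of_intertwine {w T T' K K' : Op A} (hw : IsUnit w) (hT : w * T = T' * w)
    (hK : w * K = K' * w) (h : T * K = -(K * T)) : T' * K' = -(K' * T') := by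
  refine hw.mul_right_cancel ?_
  rw [mul_assoc, ← hK, ← mul_assoc, ← hT, mul_assoc, h, mul_neg, ← mul_assoc, hK, mul_assoc, hT,
    neg_mul, mul_assoc]

theorem commute_mul_of_anti {R v K : Op A} (hR : R * K = -(K * R)) (hv : v * K = -(K * v)) :
    Commute (R * v) K := by
  change R * v * K = K * (R * v)
  rw [mul_assoc, hv, mul_neg, ← mul_assoc, hR, neg_mul, neg_neg, mul_assoc]

theorem anti_mul {R K P : Op A} (hR : Commute R P) (hK : K * P = -(P * K)) :
    (R * K) * P = -(P * (R * K)) := by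
  rw [mul_assoc, hK, mul_neg, ← mul_assoc, hR.eq, mul_assoc]

/-- The elimination move: it redirects the conjugate of `K` under `v` from `P` to `Q`. -/
theorem AntiPair.intertwine_mul {P Q v K : Op A} (h : AntiPair P Q) (hv : v * K = P * v) :
    (P + Q) * v * K = Q * ((P + Q) * v) := by
  rw [mul_assoc, hv, ← mul_assoc, h.add_mul_left, mul_assoc]

theorem AntiPair.mem_gateOps_of_mul {P Q v : Op A} (h : AntiPair P Q)
    (hv : (P + Q) * v ∈ gateOps A) : v ∈ gateOps A := by
  rw [h.eq_half_mul v]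
  exact smul_mem_gateOps (by norm_num) (mul_mem h.add_mem_gateOps hv)

theorem anti_add {P Q K : Op A} (hP : P * K = -(K * P)) (hQ : Q * K = -(K * Q)) :
    (P + Q) * K = -(K * (P + Q)) := by
  rw [add_mul, mul_add, hP, hQ, neg_add]

/-- The image of a Pauli operator of square `1` acting on `S` only, under conjugation by an operator
acting on `S` only. -/
theorem exists_conj {S : Finset A} {v K : Op A} (hu : IsUnit v) (hn : Normalizes v)
    (hs : SupportedOn S v) (hK : K ∈ pauliOps A) (hK2 : K * K = 1) (hKs : SupportedOn S K) :
    ∃ P ∈ pauliOps A, v * K = P * v ∧ P * P = 1 ∧ SupportedOn S P := by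
  obtain ⟨P, hP, h⟩ := hn K hK
  refine ⟨P, hP, h, ?_, fun j hj => ⟨?_, ?_⟩⟩
  · have := mul_self_eq_of_intertwine hu h (c := 1) (by rw [hK2, one_smul])
    rwa [one_smul] at this
  · exact commute_of_intertwine hu h (hs j hj).1.eq (hKs j hj).1
  · exact commute_of_intertwine hu h (hs j hj).2.eq (hKs j hj).2

/-- Induction on the support. At a new qubit `i`, moves `P + Q` bring the conjugate of `Z_i` to
`Z_i`, then that of `X_i` to `X_i` while changing that of `Z_i` at most by a sign. A Pauli factor at
`i` removes the signs; the result commutes with `X_i` and `Z_i`, so it is supported on `S`. -/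
theorem mem_gateOps_of_normalizes_aux (S : Finset A) : ∀ v : Op A, IsUnit v → Normalizes v →
    SupportedOn S v → v ∈ gateOps A := by
  induction S using Finset.induction_on with
  | empty =>
    intro v hu _ hs
    obtain ⟨c, rfl⟩ := exists_eq_smul_one (fun i => (hs i (by simp)).1)
      (fun i => (hs i (by simp)).2)
    refine smul_mem_gateOps ?_ (one_mem _)
    rintro rfl
    exact hu.ne_zero (zero_smul _ _)
  | insert i S hi ih =>
    have hiS : i ∈ insert i S := Finset.mem_insert_self i S
    have of_commute : ∀ v : Op A, IsUnit v → Normalizes v → SupportedOn (insert i S) v →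
        Commute v (opX i) → Commute v (opZ i) → v ∈ gateOps A := by
      intro v hu hn hs hX hZ
      refine ih v hu hn fun j hj => ?_
      by_cases h : j = i
      · subst h; exact ⟨hX, hZ⟩
      · exact hs j (by simp [h, hj])
    have fix : ∀ v R : Op A, IsUnit v → Normalizes v → SupportedOn (insert i S) v →
        R ∈ pauliOps A → R * R = 1 → SupportedOn (insert i S) R →
        Commute (R * v) (opX i) → Commute (R * v) (opZ i) → v ∈ gateOps A := by
      intro v R hu hn hs hR hR2 hRs hX hZ
      have := mul_mem (pauliOps_le_gateOps hR) (of_commute (R * v) ((isUnit_of_mem_pauliOps hR).mul hu)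
        ((normalizes_of_mem hR).mul hn) (hRs.mul hs) hX hZ)
      rwa [← mul_assoc, hR2, one_mul] at this
    -- The correcting Pauli is `X_i`, `Z_i` or `Y_i`: the one with the same signs against `X_i` and
    -- `Z_i` as `v`.
    have of_signComm : ∀ v : Op A, IsUnit v → Normalizes v → SupportedOn (insert i S) v →
        SignComm v (opX i) → SignComm v (opZ i) → v ∈ gateOps A := by
      intro v hu hn hs hX hZ
      rcases hX with hX | hX <;> rcases hZ with hZ | hZ
      · exact of_commute v hu hn hs hX hZ
      · exact fix v _ hu hn hs (opX_mem i) (opX_mul_self i) (supportedOn_opX hiS)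
          ((Commute.refl _).mul_left hX) (commute_mul_of_anti (opX_opZ_anti i) hZ)
      · exact fix v _ hu hn hs (opZ_mem i) (opZ_mul_self i) (supportedOn_opZ hiS)
          (commute_mul_of_anti (antiPair_opX_opZ i).symm.anti hX) ((Commute.refl _).mul_left hZ)
      · exact fix v _ hu hn hs (opY_mem i) (opY_mul_self i) (supportedOn_opY hiS)
          (commute_mul_of_anti (antiPair_opX_opY i).symm.anti hX)
          (commute_mul_of_anti (by rw [opZ_opY_anti, neg_neg]) hZ)
    -- The conjugate `P` of `X_i` anticommutes with `Z_i`, as do `X_i` and `Y_i`. The moves used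
    -- here therefore anticommute with `Z_i` and preserve the hypothesis on `v` up to sign.
    have of_signComm_opZ : ∀ v : Op A, IsUnit v → Normalizes v → SupportedOn (insert i S) v →
        SignComm v (opZ i) → v ∈ gateOps A := by
      intro v hu hn hs hZ
      obtain ⟨P, hP, hvP, hP2, hPs⟩ := exists_conj hu hn hs (opX_mem i) (opX_mul_self i)
        (supportedOn_opX hiS)
      have hPZ : P * opZ i = -(opZ i * P) := by
        rcases hZ with hZ | hZ
        · exact anti_of_intertwine hu hvP hZ (opX_opZ_anti i)
        · rw [← neg_mul] at hZ
          have := anti_of_intertwine hu hvP hZ (opX_opZ_anti i)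
          rwa [mul_neg, neg_mul, neg_inj] at this
      rcases pauliOps_signComm hP (opX_mem i) with hPX | hPX
      -- `P` commutes with `X_i`, so no direct move exists; the route is `P → Y_i → X_i`.
      · have hYZ : opY i * opZ i = -(opZ i * opY i) := by rw [opZ_opY_anti, neg_neg]
        have h1 : AntiPair P (opY i) := ⟨hP, opY_mem i, hP2, opY_mul_self i, by
          rw [opY, mul_smul_comm, ← mul_assoc, hPX, mul_assoc, hPZ, smul_mul_assoc, mul_neg,
            smul_neg, mul_assoc]⟩
        have h2 := (antiPair_opX_opY i).symm
        refine h1.mem_gateOps_of_mul (h2.mem_gateOps_of_mul (of_signComm _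
          (h2.isUnit_add.mul (h1.isUnit_add.mul hu)) (h2.normalizes.mul (h1.normalizes.mul hn))
          (((supportedOn_opY hiS).add (supportedOn_opX hiS)).mul
            ((hPs.add (supportedOn_opY hiS)).mul hs))
          (Or.inl (h2.intertwine_mul (h1.intertwine_mul hvP))) ?_))
        exact SignComm.mul_left (Or.inr (anti_add hYZ (opX_opZ_anti i)))
          (SignComm.mul_left (Or.inr (anti_add hPZ hYZ)) hZ)
      · have h1 : AntiPair P (opX i) := ⟨hP, opX_mem i, hP2, opX_mul_self i, hPX⟩
        exact h1.mem_gateOps_of_mul (of_signComm _ (h1.isUnit_add.mul hu) (h1.normalizes.mul hn)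
          ((hPs.add (supportedOn_opX hiS)).mul hs) (Or.inl (h1.intertwine_mul hvP))
          (SignComm.mul_left (Or.inr (anti_add hPZ (opX_opZ_anti i))) hZ))
    intro v hu hn hs
    obtain ⟨P, hP, hvP, hP2, hPs⟩ := exists_conj hu hn hs (opZ_mem i) (opZ_mul_self i)
      (supportedOn_opZ hiS)
    by_cases hPZ : Commute P (opZ i)
    -- `P` commutes with `Z_i`, so the route goes through some `R` anticommuting with both.
    · suffices ∃ R, AntiPair P R ∧ AntiPair R (opZ i) ∧ SupportedOn (insert i S) R by
        obtain ⟨R, h1, h2, hRs⟩ := this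
        exact h1.mem_gateOps_of_mul (h2.mem_gateOps_of_mul (of_signComm_opZ _
          (h2.isUnit_add.mul (h1.isUnit_add.mul hu)) (h2.normalizes.mul (h1.normalizes.mul hn))
          ((hRs.add (supportedOn_opZ hiS)).mul ((hPs.add hRs).mul hs))
          (Or.inl (h2.intertwine_mul (h1.intertwine_mul hvP)))))
      rcases pauliOps_signComm hP (opX_mem i) with hPX | hPX
      -- `P` is trivial at `i`. If it anticommutes with some `G` at another qubit, `R = X_i G`
      -- works: `G` provides the sign against `P`, and `X_i` the sign against `Z_i`.
      · have key : ∀ j G, j ≠ i → j ∈ insert i S → G ∈ pauliOps A → G * G = 1 →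
            SupportedOn {j} G → SupportedOn (insert i S) G → ¬ Commute P G →
            ∃ R, AntiPair P R ∧ AntiPair R (opZ i) ∧ SupportedOn (insert i S) R := by
          intro j G hji hj hG hG2 hGj hGs hPG
          have hPG := (pauliOps_signComm hP hG).resolve_left hPG
          have hi' : i ∉ ({j} : Finset A) := by simpa using hji.symm
          have hGP : G * P = -(P * G) := by rw [hPG, neg_neg]
          have hR2 : opX i * G * (opX i * G) = 1 := by
            rw [mul_assoc, ← mul_assoc G, (hGj i hi').1.eq, mul_assoc, hG2, mul_one, opX_mul_self]
          have hRm := mul_mem (opX_mem i) hG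
          refine ⟨opX i * G, ⟨hP, hRm, hP2, hR2, ?_⟩,
            ⟨hRm, opZ_mem i, hR2, opZ_mul_self i, ?_⟩, (supportedOn_opX hiS).mul hGs⟩
          · rw [anti_mul hPX.symm hGP, neg_neg]
          · rw [(hGj i hi').1.symm.eq]
            exact anti_mul (hGj i hi').2 (opX_opZ_anti i)
        -- Without such a `G`, irreducibility makes `P` a scalar, hence also its conjugate `Z_i`,
        -- which anticommutes with `X_i`.
        by_contra hcon
        have hall : ∀ j, Commute P (opX j) ∧ Commute P (opZ j) := by
          intro j
          by_cases hji : j = i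
          · subst hji; exact ⟨hPX, hPZ⟩
          by_cases hj : j ∈ insert i S
          · have hjj := Finset.mem_singleton_self j
            exact ⟨by_contra fun h => hcon (key j _ hji hj (opX_mem j) (opX_mul_self j)
                (supportedOn_opX hjj) (supportedOn_opX hj) h),
              by_contra fun h => hcon (key j _ hji hj (opZ_mem j) (opZ_mul_self j)
                (supportedOn_opZ hjj) (supportedOn_opZ hj) h)⟩
          · exact hPs j hj
        obtain ⟨c, rfl⟩ := exists_eq_smul_one (fun j => (hall j).1) (fun j => (hall j).2)
        have hZ : opZ i = c • (1 : Op A) := by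
          refine hu.mul_left_cancel ?_
          rw [hvP, smul_mul_assoc, one_mul, mul_smul_comm, mul_one]
        have h1 := opX_opZ_anti i
        rw [hZ, mul_smul_comm, smul_mul_assoc, one_mul, mul_one] at h1
        have h2 : (2 : ℂ) • (c • opX i) = 0 := by
          rw [two_smul]; nth_rewrite 1 [h1]; simp
        have h3 := (smul_eq_zero.1 h2).resolve_left two_ne_zero
        have h4 := (smul_eq_zero.1 h3).resolve_right (isUnit_of_mem_pauliOps (opX_mem i)).ne_zero
        rw [h4, zero_smul] at hZ
        exact (isUnit_of_mem_pauliOps (opZ_mem i)).ne_zero hZ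
      · exact ⟨opX i, ⟨hP, opX_mem i, hP2, opX_mul_self i, hPX⟩, antiPair_opX_opZ i,
          supportedOn_opX hiS⟩
    · have h1 : AntiPair P (opZ i) := ⟨hP, opZ_mem i, hP2, opZ_mul_self i,
        (pauliOps_signComm hP (opZ_mem i)).resolve_left hPZ⟩
      exact h1.mem_gateOps_of_mul (of_signComm_opZ _ (h1.isUnit_add.mul hu) (h1.normalizes.mul hn)
        ((hPs.add (supportedOn_opZ hiS)).mul hs) (Or.inl (h1.intertwine_mul hvP)))

/-- The invertible operators that normalise the Pauli operators are generated by the gates. -/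
theorem mem_gateOps_of_normalizes {v : Op A} (hu : IsUnit v) (hn : Normalizes v) :
    v ∈ gateOps A :=
  mem_gateOps_of_normalizes_aux Finset.univ v hu hn fun j hj => absurd (Finset.mem_univ j) hj

theorem toOp_mem_pauliOps {P : Hil A ≃ₗᵢ[ℂ] Hil A} (hP : P ∈ pauliGroup A) :
    toOp P ∈ pauliOps A := by
  induction hP using Subgroup.closure_induction with
  | mem P h =>
    rcases h with (⟨i, rfl⟩ | ⟨i, rfl⟩) | rfl
    · exact opX_mem i
    · exact opZ_mem i
    · exact I_smul_mem (one_mem _)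
  | one => rw [map_one]; exact one_mem _
  | mul P Q _ _ h1 h2 => rw [map_mul]; exact mul_mem h1 h2
  | inv P _ h =>
    obtain ⟨P', hP', h1, -⟩ := exists_pauliOps_inv h
    have h2 : toOp P⁻¹ * toOp P = 1 := by rw [← map_mul, inv_mul_cancel, map_one]
    rwa [← left_inv_eq_right_inv h2 h1] at hP'

theorem exists_toOp_eq {M : Op A} (hM : M ∈ pauliOps A) : ∃ P ∈ pauliGroup A, toOp P = M := by
  have hmem : ∀ g, g ∈ Set.range pauliX ∪ Set.range pauliZ ∪ {scalarI A} → g ∈ pauliGroup A :=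
    fun g hg => Subgroup.subset_closure hg
  refine pauliOps_induction (p := fun M => ∃ P ∈ pauliGroup A, toOp P = M)
    ⟨1, one_mem _, map_one _⟩ ?_ ?_ ?_ hM
  · rintro i - - ⟨P, hP, rfl⟩
    exact ⟨pauliX i * P, mul_mem (hmem _ (Or.inl (Or.inl ⟨i, rfl⟩))) hP, map_mul _ _ _⟩
  · rintro i - - ⟨P, hP, rfl⟩
    exact ⟨pauliZ i * P, mul_mem (hmem _ (Or.inl (Or.inr ⟨i, rfl⟩))) hP, map_mul _ _ _⟩
  · rintro - - ⟨P, hP, rfl⟩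
    exact ⟨scalarI A * P, mul_mem (hmem _ (Or.inr rfl)) hP, rfl⟩

theorem mem_cliffordGroup_iff {U : Hil A ≃ₗᵢ[ℂ] Hil A} :
    U ∈ cliffordGroup A ↔
      (∀ P ∈ pauliOps A, ∃ P' ∈ pauliOps A, toOp U * P = P' * toOp U) ∧
        ∀ P' ∈ pauliOps A, ∃ P ∈ pauliOps A, toOp U * P = P' * toOp U := by
  have hconj : ∀ P P' : Hil A ≃ₗᵢ[ℂ] Hil A,
      toOp U * toOp P = toOp P' * toOp U ↔ U * P * U⁻¹ = P' := by
    intro P P'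
    rw [← map_mul, ← map_mul, toOp_injective.eq_iff, mul_inv_eq_iff_eq_mul]
  rw [cliffordGroup, Subgroup.mem_normalizer_iff]
  constructor
  · refine fun h => ⟨fun M hM => ?_, fun M hM => ?_⟩
    · obtain ⟨P, hP, rfl⟩ := exists_toOp_eq hM
      exact ⟨_, toOp_mem_pauliOps ((h P).1 hP), (hconj _ _).2 rfl⟩
    · obtain ⟨P, hP, rfl⟩ := exists_toOp_eq hM
      have h1 : U * (U⁻¹ * P * U) * U⁻¹ = P := by group
      exact ⟨_, toOp_mem_pauliOps ((h (U⁻¹ * P * U)).2 (by rw [h1]; exact hP)), (hconj _ _).2 h1⟩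
  · rintro ⟨h1, h2⟩ P
    constructor
    · intro hP
      obtain ⟨M, hM, h⟩ := h1 _ (toOp_mem_pauliOps hP)
      obtain ⟨P', hP', rfl⟩ := exists_toOp_eq hM
      rw [(hconj _ _).1 h]; exact hP'
    · intro hP
      obtain ⟨M, hM, h⟩ := h2 _ (toOp_mem_pauliOps hP)
      obtain ⟨P', hP', rfl⟩ := exists_toOp_eq hM
      have : P' = P := mul_left_cancel (mul_right_cancel ((hconj _ _).1 h))
      rwa [← this]

end Elimination

/-! ### Runs of a pattern as operators on the space of all qubits. -/

section Semantics

variable {V I : Type*} [DecidableEq V] [Fintype V]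

/-- A state on the live qubits, seen as a function of the bits of all qubits. -/
def CState.vec (S : CState V) : Hil V := WithLp.toLp 2 fun x => S.state fun k => x k

theorem CState.vec_apply (S : CState V) (x : V → Fin 2) : S.vec x = S.state fun k => x k := rfl

/-- The linear form `⟨ψ|` applied at the qubit `i`; the result does not depend on the bit `i`. -/
def braOp (i : V) (ψ : Fin 2 → ℂ) : Op V where
  toFun q := WithLp.toLp 2 fun x => ∑ b : Fin 2, (starRingEnd ℂ) (ψ b) * q (Function.update x i b)
  map_add' p q := by
    ext x
    simp [mul_add]
    ring
  map_smul' c q := by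
    ext x
    simp
    ring

theorem braOp_apply (i : V) (ψ : Fin 2 → ℂ) (q : Hil V) (x : V → Fin 2) :
    braOp i ψ q x = ∑ b : Fin 2, (starRingEnd ℂ) (ψ b) * q (Function.update x i b) := rfl

/-- The operator by which a command acts, given the outcome maps before and after it. -/
def stepOp (Γ Γ' : Outcomes V) : Command V → Op V
  | .ent i j _ => toOp (ctrlZ i j)
  | .corrX i s => opX i ^ (s.value Γ).val
  | .corrZ i s => opZ i ^ (s.value Γ).val
  -- The outcome is read after the measurement has recorded it, so the default `0` plays no role in
  -- a run.
  | .meas α i s t => braOp i (measKet (actualAngle α s t Γ) ((Γ' i).getD 0))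

theorem vec_pauliX_pow {W : Finset V} {i : V} (hi : i ∈ W) (q : Hil W) (Γ : Outcomes V) (n : ℕ) :
    (⟨W, (pauliX ⟨i, hi⟩ ^ n) q, Γ⟩ : CState V).vec = (opX i ^ n) (⟨W, q, Γ⟩ : CState V).vec := by
  induction n generalizing q with
  | zero => rfl
  | succ n ih =>
    rw [pow_succ, pow_succ]
    change (⟨W, (pauliX ⟨i, hi⟩ ^ n) (pauliX ⟨i, hi⟩ q), Γ⟩ : CState V).vec = (opX i ^ n) (opX i _)
    rw [ih]
    congr 1
    ext x
    rw [opX_apply, CState.vec_apply, CState.vec_apply]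
    change pauliX ⟨i, hi⟩ q _ = q _
    rw [pauliX_apply]
    refine congrArg q (funext fun k => ?_)
    by_cases h : k = ⟨i, hi⟩
    · subst h; simp [flipBit]
    · have : (k : V) ≠ i := fun h' => h (Subtype.ext h')
      rw [flipBit_ne h, flipBit_ne this]

theorem vec_pauliZ_pow {W : Finset V} {i : V} (hi : i ∈ W) (q : Hil W) (Γ : Outcomes V) (n : ℕ) :
    (⟨W, (pauliZ ⟨i, hi⟩ ^ n) q, Γ⟩ : CState V).vec = (opZ i ^ n) (⟨W, q, Γ⟩ : CState V).vec := by
  induction n generalizing q with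
  | zero => rfl
  | succ n ih =>
    rw [pow_succ, pow_succ]
    change (⟨W, (pauliZ ⟨i, hi⟩ ^ n) (pauliZ ⟨i, hi⟩ q), Γ⟩ : CState V).vec = (opZ i ^ n) (opZ i _)
    rw [ih]
    refine congrArg _ (PiLp.ext fun x => ?_)
    rw [opZ_apply, CState.vec_apply, CState.vec_apply]
    exact pauliZ_apply (⟨i, hi⟩ : W) q fun k => x k

/-- Consumed qubits stay in `vec` as bits that are ignored. States with different live sets thus
share one space, and a run becomes a product of operators. -/
theorem Step.vec_eq {c : Command V} {S S' : CState V} (h : Step c S S') :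
    S'.vec = stepOp S.outcomes S'.outcomes c S.vec := by
  cases h with
  | @ent W q Γ i j hij hi hj =>
    ext x
    change ctrlZ (⟨i, hi⟩ : W) ⟨j, hj⟩ q (fun k => x k) =
      ctrlZ i j (⟨W, q, Γ⟩ : CState V).vec x
    rw [ctrlZ_apply, ctrlZ_apply]
    rfl
  | corrX hi hs => exact vec_pauliX_pow hi _ _ _
  | corrZ hi hs => exact vec_pauliZ_pow hi _ _ _
  | @meas W q Γ α i s t hi hs ht b =>
    ext x
    change ∑ b' : Fin 2, (starRingEnd ℂ) (measKet (actualAngle α s t Γ) b b') *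
        q (extendBit i (fun k => x k) b') =
      ∑ b' : Fin 2, (starRingEnd ℂ)
        (measKet (actualAngle α s t Γ) ((Function.update Γ i (some b) i).getD 0) b') *
          q fun k => Function.update x i b' k
    rw [Function.update_self]
    refine Finset.sum_congr rfl fun b' _ => ?_
    refine congrArg (fun y => _ * q y) (funext fun k => ?_)
    by_cases h : (k : V) = i
    · simp [extendBit, h]
    · simp [extendBit, h]

theorem Step.outcomes_eq {c : Command V} {S S' : CState V} (h : Step c S S')
    (hc : c.measures = ∅) : S'.outcomes = S.outcomes := by
  cases h <;> first | rfl | simp [Command.measures] at hc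

theorem Exec.of_append {l l' : List (Command V)} {S S'' : CState V} (h : Exec (l ++ l') S S'') :
    ∃ S', Exec l S S' ∧ Exec l' S' S'' := by
  induction l generalizing S with
  | nil => exact ⟨S, .nil S, h⟩
  | cons c l ih =>
    cases h with
    | cons hs h =>
      obtain ⟨S', h1, h2⟩ := ih h
      exact ⟨S', .cons hs h1, h2⟩

theorem Exec.of_cons {c : Command V} {l : List (Command V)} {S S'' : CState V}
    (h : Exec (c :: l) S S'') : ∃ S', Step c S S' ∧ Exec l S' S'' := by
  cases h with
  | cons hs h => exact ⟨_, hs, h⟩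

/-- After the qubits in `M` have been measured, the commands only depend on outcomes already
obtained, and only act on qubits not yet measured. -/
def WellFormed : Finset V → List (Command V) → Prop
  | _, [] => True
  | M, c :: l => c.deps ⊆ M ∧ Disjoint c.qubits M ∧ WellFormed (c.measures ∪ M) l

theorem measured_cons (c : Command V) (l : List (Command V)) :
    measured (c :: l) = c.measures ∪ measured l := rfl

theorem measured_append (l l' : List (Command V)) :
    measured (l ++ l') = measured l ∪ measured l' := by
  induction l with
  | nil => simp [measured]
  | cons c l ih => rw [List.cons_append, measured_cons, measured_cons, ih, Finset.union_assoc]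

theorem wellFormed_append {l l' : List (Command V)} {M : Finset V} :
    WellFormed M (l ++ l') ↔ WellFormed M l ∧ WellFormed (M ∪ measured l) l' := by
  induction l generalizing M with
  | nil => simp [WellFormed, measured]
  | cons c l ih =>
    have : c.measures ∪ M ∪ measured l = M ∪ measured (c :: l) := by
      rw [measured_cons, Finset.union_comm c.measures, Finset.union_assoc]
    simp only [List.cons_append, WellFormed, ih, this, and_assoc]

/-- The measured qubits are gone, and their outcomes are known. -/
def Admissible (M : Finset V) (S : CState V) : Prop :=
  S.live = Mᶜ ∧ ∀ i ∈ M, (S.outcomes i).isSome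

theorem Step.admissible {c : Command V} {S S' : CState V} {M : Finset V} (h : Step c S S')
    (hM : Admissible M S) : Admissible (c.measures ∪ M) S' := by
  cases h with
  | ent | corrX | corrZ => exact ⟨hM.1.trans (by simp [Command.measures]), by
      simpa [Command.measures] using hM.2⟩
  | @meas W q Γ α i s t hi hs ht b =>
    obtain ⟨h1, h2⟩ := hM
    change W = Mᶜ at h1
    refine ⟨?_, ?_⟩
    · change W.erase i = _
      rw [h1]
      ext k
      simp [Command.measures]
    · intro k hk
      change (Function.update Γ i (some b) k).isSome
      by_cases hki : k = i
      · subst hki; simp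
      · rw [Function.update_of_ne hki]
        refine h2 k ?_
        simpa [Command.measures, hki] using hk

/-- Progress: known dependencies and live qubits are all that a command needs. For a measurement,
outcome `0` is chosen. -/
theorem Step.exists {c : Command V} {S : CState V} {M : Finset V} (hM : Admissible M S)
    (hd : c.deps ⊆ M) (hq : Disjoint c.qubits M) : ∃ S', Step c S S' := by
  obtain ⟨W, q, Γ⟩ := S
  obtain ⟨h1, h2⟩ := hM
  change W = Mᶜ at h1
  have hW : ∀ i ∈ c.qubits, i ∈ W := by
    intro i hi
    rw [h1, Finset.mem_compl]
    exact Finset.disjoint_left.1 hq hi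
  have hs : ∀ s : Signal V, s.dom ⊆ M → s.DefinedAt Γ := fun s hs i hi => h2 i (hs hi)
  cases c with
  | ent i j hij =>
    exact ⟨_, .ent hij (hW i (by simp [Command.qubits])) (hW j (by simp [Command.qubits]))⟩
  | corrX i s => exact ⟨_, .corrX (hW i (by simp [Command.qubits])) (hs s hd)⟩
  | corrZ i s => exact ⟨_, .corrZ (hW i (by simp [Command.qubits])) (hs s hd)⟩
  | meas α i s t =>
    exact ⟨_, .meas (hW i (by simp [Command.qubits])) (hs s (Finset.union_subset_left hd))
      (hs t (Finset.union_subset_right hd)) 0⟩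

theorem Exec.admissible {l : List (Command V)} {S S' : CState V} {M : Finset V} (h : Exec l S S')
    (hM : Admissible M S) : Admissible (M ∪ measured l) S' := by
  induction h generalizing M with
  | nil => simpa [measured] using hM
  | cons hs _ ih =>
    have := ih (hs.admissible hM)
    rwa [Finset.union_comm _ M, Finset.union_assoc, ← measured_cons] at this

theorem Exec.exists {l : List (Command V)} {S : CState V} {M : Finset V} (hM : Admissible M S)
    (hl : WellFormed M l) : ∃ S', Exec l S S' := by
  induction l generalizing M S with
  | nil => exact ⟨S, .nil S⟩
  | cons c l ih =>
    obtain ⟨S', hs⟩ := Step.exists hM hl.1 hl.2.1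
    obtain ⟨S'', h⟩ := ih (hs.admissible hM) hl.2.2
    exact ⟨S'', .cons hs h⟩

/-- The state of the qubits `f i`, as a function of the bits of all qubits. -/
def pullback (f : I → V) : Hil I →ₗ[ℂ] Hil V where
  toFun q := WithLp.toLp 2 fun x => q (x ∘ f)
  map_add' _ _ := rfl
  map_smul' _ _ := rfl

theorem pullback_apply (f : I → V) (q : Hil I) (x : V → Fin 2) : pullback f q x = q (x ∘ f) := rfl

theorem pullback_injective (f : I ↪ V) : Function.Injective (pullback f) := by
  intro p q h
  ext y
  have := congrArg (fun r : Hil V => r (Function.extend f y 0)) h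
  have hy : Function.extend f y 0 ∘ f = y := funext fun i => f.injective.extend_apply _ _ i
  simpa only [pullback_apply, hy] using this

theorem ketPlus_apply (b : Fin 2) : ketPlus b = 1 / (Real.sqrt 2 : ℂ) := by
  fin_cases b <;> simp [ketPlus, measKet]

variable {O : Type*} [Fintype O]

/-- The amplitude `(1/√2)^{|V ∖ I|}` of the prepared qubits. -/
theorem exists_vec_prep (P : Pattern V I O) : ∃ c : ℂ, c ≠ 0 ∧ ∀ q : Hil I, ∀ Γ,
    (⟨Finset.univ, P.prep q, Γ⟩ : CState V).vec = c • pullback P.inp q := by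
  classical
  refine ⟨∏ v ∈ Finset.univ.filter (fun v : V => v ∉ Set.range P.inp), 1 / (Real.sqrt 2 : ℂ),
    ?_, fun q Γ => ?_⟩
  · exact Finset.prod_ne_zero_iff.2 fun _ _ => by simp
  · ext x
    rw [CState.vec_apply]
    change q _ * _ = _ * q _
    rw [mul_comm]
    simp only [ketPlus_apply]
    rfl

theorem vec_embedOut (P : Pattern V I O) (q : Hil O) (Γ : Outcomes V) :
    (⟨P.outputs, P.embedOut q, Γ⟩ : CState V).vec = pullback P.out q := rfl

theorem embedOut_surjective (P : Pattern V I O) (r : Hil ↥P.outputs) : ∃ q, P.embedOut q = r := by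
  classical
  refine ⟨WithLp.toLp 2 fun y => r fun k => Function.extend P.out y 0 k, ?_⟩
  ext x
  refine congrArg r (funext fun ⟨k, hk⟩ => ?_)
  obtain ⟨o, -, rfl⟩ := Finset.mem_map.1 hk
  exact P.out.injective.extend_apply _ _ o

end Semantics

/-! ### Stabilizer maps: patterns with Pauli measurements implement only Clifford operators. -/

section Stabilizer

variable {V I : Type*} [DecidableEq V] [Fintype V] [DecidableEq I] [Fintype I]

/-- The Hilbert–Schmidt inner product. -/
def hsInner (A B : Hil I →ₗ[ℂ] Hil V) : ℂ :=
  ∑ y : I → Fin 2, inner ℂ (A (basisKet y)) (B (basisKet y))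

theorem hsInner_add_right (A B C : Hil I →ₗ[ℂ] Hil V) :
    hsInner A (B + C) = hsInner A B + hsInner A C := by
  simp [hsInner, Finset.sum_add_distrib]

theorem hsInner_smul_right (A B : Hil I →ₗ[ℂ] Hil V) (c : ℂ) :
    hsInner A (c • B) = c * hsInner A B := by
  simp [hsInner, Finset.mul_sum]

theorem hsInner_smul_left (A B : Hil I →ₗ[ℂ] Hil V) (c : ℂ) :
    hsInner (c • A) B = (starRingEnd ℂ) c * hsInner A B := by
  simp only [hsInner, LinearMap.smul_apply, inner_smul_left, Finset.mul_sum]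

theorem hsInner_neg_right (A B : Hil I →ₗ[ℂ] Hil V) : hsInner A (-B) = -hsInner A B := by
  simp [hsInner]

theorem hsInner_comp {C : Op V} (hC : ∀ p q, inner ℂ (C p) (C q) = inner ℂ p q)
    (A B : Hil I →ₗ[ℂ] Hil V) : hsInner (C ∘ₗ A) (C ∘ₗ B) = hsInner A B := by
  simp [hsInner, hC]

theorem inner_toOp (U : Hil V ≃ₗᵢ[ℂ] Hil V) (p q : Hil V) :
    inner ℂ (toOp U p) (toOp U q) = inner ℂ p q := U.inner_map_map p q

theorem inner_pauliOps {P : Op V} (hP : P ∈ pauliOps V) (p q : Hil V) :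
    inner ℂ (P p) (P q) = inner ℂ p q := by
  obtain ⟨U, -, rfl⟩ := exists_toOp_eq hP
  exact inner_toOp U p q

theorem hsInner_opX_comp (i : V) (A B : Hil I →ₗ[ℂ] Hil V) :
    hsInner (opX i ∘ₗ A) B = hsInner A (opX i ∘ₗ B) := by
  rw [← hsInner_comp (inner_pauliOps (opX_mem i)) A, ← LinearMap.comp_assoc]
  change _ = hsInner _ ((opX i * opX i) ∘ₗ B)
  rw [opX_mul_self]
  rfl

theorem hsInner_comp_opX (i : I) (A B : Hil I →ₗ[ℂ] Hil V) :
    hsInner (A ∘ₗ opX i) (B ∘ₗ opX i) = hsInner A B := by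
  simp only [hsInner, LinearMap.comp_apply, opX_basisKet]
  exact Equiv.sum_comp (flipPerm i) fun y => inner ℂ (A (basisKet y)) (B (basisKet y))

theorem hsInner_comp_opZ (i : I) (A B : Hil I →ₗ[ℂ] Hil V) :
    hsInner (A ∘ₗ opZ i) (B ∘ₗ opZ i) = hsInner A B := by
  refine Finset.sum_congr rfl fun y _ => ?_
  simp only [LinearMap.comp_apply, opZ_basisKet]
  split_ifs <;> simp

/-- The linear maps whose Choi vector is proportional to a stabilizer state. -/
def IsStabilizer (A : Hil I →ₗ[ℂ] Hil V) : Prop :=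
  ∀ P ∈ pauliOps I, ∀ P' ∈ pauliOps V,
    (∃ c : ℂ, P' ∘ₗ A ∘ₗ P = c • A) ∨ hsInner A (P' ∘ₗ A ∘ₗ P) = 0

theorem IsStabilizer.smul {A : Hil I →ₗ[ℂ] Hil V} (h : IsStabilizer A) (c : ℂ) :
    IsStabilizer (c • A) := by
  intro P hP P' hP'
  have h1 : P' ∘ₗ (c • A) ∘ₗ P = c • (P' ∘ₗ A ∘ₗ P) := by
    rw [LinearMap.smul_comp, LinearMap.comp_smul]
  rcases h P hP P' hP' with ⟨d, h⟩ | h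
  · exact Or.inl ⟨d, by rw [h1, h, smul_comm]⟩
  · exact Or.inr (by rw [h1, hsInner_smul_left, hsInner_smul_right, h, mul_zero, mul_zero])

theorem IsStabilizer.isometry_comp {A : Hil I →ₗ[ℂ] Hil V} (h : IsStabilizer A) {C : Op V}
    (hC : ∀ p q, inner ℂ (C p) (C q) = inner ℂ p q)
    (hn : ∀ P ∈ pauliOps V, ∃ P' ∈ pauliOps V, P * C = C * P') : IsStabilizer (C ∘ₗ A) := by
  intro P hP P' hP'
  obtain ⟨P'', hP'', h2⟩ := hn P' hP'
  have h1 : P' ∘ₗ (C ∘ₗ A) ∘ₗ P = C ∘ₗ (P'' ∘ₗ A ∘ₗ P) := by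
    change (P' * C) ∘ₗ A ∘ₗ P = (C * P'') ∘ₗ A ∘ₗ P
    rw [h2]
  rcases h P hP P'' hP'' with ⟨c, h⟩ | h
  · exact Or.inl ⟨c, by rw [h1, h, LinearMap.comp_smul]⟩
  · exact Or.inr (by rw [h1, hsInner_comp hC, h])

/-- Let `Π = 1 + X_i`, which is self-adjoint with `Π X_i = Π` and `Π² = 2 Π`. If `P'` anticommutes
with `X_i`, then `Π P' Π = 0`. If it commutes, then `P' Π A P` is both `Π (P' A P)` and `Π (X_i P' A
P)`: either one of the inner maps is a multiple of `A`, or both are orthogonal to `A`, and then so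
is twice their sum, `Π Π P' A P`. -/
theorem IsStabilizer.one_add_opX_comp {A : Hil I →ₗ[ℂ] Hil V} (h : IsStabilizer A) (i : V) :
    IsStabilizer ((1 + opX i) ∘ₗ A) := by
  intro P hP P' hP'
  have hX : (1 + opX i) * opX i = 1 + opX i := by
    rw [add_mul, one_mul, opX_mul_self, add_comm]
  have hsym : ∀ B : Hil I →ₗ[ℂ] Hil V,
      hsInner ((1 + opX i) ∘ₗ A) B = hsInner A ((1 + opX i) ∘ₗ B) := by
    intro B
    have h1 : ∀ B : Hil I →ₗ[ℂ] Hil V, (1 + opX i) ∘ₗ B = B + opX i ∘ₗ B := fun B => by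
      rw [LinearMap.add_comp]; rfl
    have h2 : hsInner (A + opX i ∘ₗ A) B = hsInner A B + hsInner (opX i ∘ₗ A) B := by
      simp [hsInner, Finset.sum_add_distrib]
    rw [h1, h1, h2, hsInner_opX_comp, hsInner_add_right]
  rcases pauliOps_signComm hP' (opX_mem i) with hc | hc
  · have hc' : P' * (1 + opX i) = (1 + opX i) * P' := by rw [mul_add, add_mul, hc, mul_one, one_mul]
    have hc'' : P' * (1 + opX i) = (1 + opX i) * (opX i * P') := by
      rw [hc', ← mul_assoc, hX]
    have e1 : P' ∘ₗ ((1 + opX i) ∘ₗ A) ∘ₗ P = (1 + opX i) ∘ₗ (P' ∘ₗ A ∘ₗ P) := by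
      change (P' * (1 + opX i)) ∘ₗ A ∘ₗ P = ((1 + opX i) * P') ∘ₗ A ∘ₗ P
      rw [hc']
    have e2 : P' ∘ₗ ((1 + opX i) ∘ₗ A) ∘ₗ P = (1 + opX i) ∘ₗ ((opX i * P') ∘ₗ A ∘ₗ P) := by
      change (P' * (1 + opX i)) ∘ₗ A ∘ₗ P = ((1 + opX i) * (opX i * P')) ∘ₗ A ∘ₗ P
      rw [hc'']
    rcases h P hP P' hP' with ⟨c, h1⟩ | h1
    · exact Or.inl ⟨c, by rw [e1, h1, LinearMap.comp_smul]⟩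
    rcases h P hP _ (mul_mem (opX_mem i) hP') with ⟨c, h2⟩ | h2
    · exact Or.inl ⟨c, by rw [e2, h2, LinearMap.comp_smul]⟩
    right
    have e3 : (1 + opX i) ∘ₗ ((1 + opX i) ∘ₗ (P' ∘ₗ A ∘ₗ P)) =
        (2 : ℂ) • (P' ∘ₗ A ∘ₗ P + (opX i * P') ∘ₗ A ∘ₗ P) := by
      have : (1 + opX i) * ((1 + opX i) * P') = (2 : ℂ) • (P' + opX i * P') := by
        rw [← mul_assoc, mul_add (1 + opX i), hX, mul_one, ← two_smul ℂ, smul_mul_assoc, add_mul,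
          one_mul]
      calc _ = ((1 + opX i) * ((1 + opX i) * P')) ∘ₗ A ∘ₗ P := rfl
        _ = _ := by rw [this]; rfl
    rw [hsym, e1, e3, hsInner_smul_right, hsInner_add_right, h1, h2, add_zero, mul_zero]
  · right
    have h0 : (1 + opX i) * (P' * (1 + opX i)) = 0 := by
      rw [mul_add P', hc, mul_one, mul_add, mul_neg, ← mul_assoc, hX, add_neg_cancel]
    have : (1 + opX i) ∘ₗ (P' ∘ₗ ((1 + opX i) ∘ₗ A) ∘ₗ P) = 0 := by
      calc _ = ((1 + opX i) * (P' * (1 + opX i))) ∘ₗ A ∘ₗ P := rfl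
        _ = 0 := by rw [h0, LinearMap.zero_comp]
    rw [hsym, this]
    simp [hsInner]

theorem exists_mul_eq_of_generators {C : Op V}
    (hX : ∀ i, ∃ P ∈ pauliOps V, opX i * C = C * P) (hZ : ∀ i, opZ i * C = C * opZ i) :
    ∀ P ∈ pauliOps V, ∃ P' ∈ pauliOps V, P * C = C * P' := by
  intro P hP
  refine pauliOps_induction (p := fun P => ∃ P' ∈ pauliOps V, P * C = C * P')
    ⟨1, one_mem _, by simp⟩ ?_ ?_ ?_ hP
  · rintro i P - ⟨P', hP', h⟩
    obtain ⟨Q, hQ, h2⟩ := hX i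
    exact ⟨Q * P', mul_mem hQ hP', by rw [mul_assoc, h, ← mul_assoc, h2, mul_assoc]⟩
  · rintro i P - ⟨P', hP', h⟩
    exact ⟨opZ i * P', mul_mem (opZ_mem i) hP', by rw [mul_assoc, h, ← mul_assoc, hZ, mul_assoc]⟩
  · rintro P - ⟨P', hP', h⟩
    exact ⟨_, I_smul_mem hP', by rw [smul_mul_assoc, h, mul_smul_comm]⟩

/-- The operator `diag(1, ω)` at the qubit `i`. -/
def phaseOp (i : V) (ω : ℂ) : Op V where
  toFun q := WithLp.toLp 2 fun x => (if x i = 1 then ω else 1) * q x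
  map_add' p q := by ext x; exact mul_add _ _ _
  map_smul' c q := by ext x; exact mul_left_comm _ _ _

theorem phaseOp_apply (i : V) (ω : ℂ) (q : Hil V) (x : V → Fin 2) :
    phaseOp i ω q x = (if x i = 1 then ω else 1) * q x := rfl

theorem inner_phaseOp (i : V) {ω : ℂ} (hω : ω ^ 4 = 1) (p q : Hil V) :
    inner ℂ (phaseOp i ω p) (phaseOp i ω q) = inner ℂ p q := by
  have h1 : ‖ω‖ = 1 := (pow_eq_one_iff_of_nonneg (norm_nonneg ω) (by norm_num : 4 ≠ 0)).1 (by
    rw [← norm_pow, hω, norm_one])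
  have h2 : ω * (starRingEnd ℂ) ω = 1 := by rw [Complex.mul_conj, Complex.normSq_eq_norm_sq, h1]; simp
  rw [PiLp.inner_apply, PiLp.inner_apply]
  refine Finset.sum_congr rfl fun x _ => ?_
  rw [phaseOp_apply, phaseOp_apply]
  split_ifs
  · simp only [RCLike.inner_apply, map_mul]
    linear_combination (q x * (starRingEnd ℂ) (p x)) * h2
  · rw [one_mul, one_mul]

theorem fin2_cases (b : Fin 2) : b = 0 ∨ b = 1 := by revert b; decide

/-- Moving `X_i` through `diag(1, ω)` gives `ω X_i` if `ω² = 1` and `ω Z_i X_i` if `ω² = -1`; the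
other generators commute with it. -/
theorem exists_mul_phaseOp (i : V) {ω : ℂ} (hω : ω ^ 4 = 1) :
    ∀ P ∈ pauliOps V, ∃ P' ∈ pauliOps V, P * phaseOp i ω = phaseOp i ω * P' := by
  refine exists_mul_eq_of_generators (fun j => ?_) (fun j => ?_)
  · by_cases hj : j = i
    · subst hj
      have h0 : (ω ^ 2 - 1) * (ω ^ 2 + 1) = 0 := by linear_combination hω
      rcases mul_eq_zero.1 h0 with h | h
      · refine ⟨_, smul_mem_pauliOps (opX_mem j) hω, op_ext fun q x => ?_⟩
        change phaseOp j ω q (flipBit j x) = phaseOp j ω (ω • opX j q) x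
        rw [phaseOp_apply, phaseOp_apply, flipBit_same]
        change _ = _ * (ω * q (flipBit j x))
        rcases fin2_cases (x j) with h' | h' <;> simp [h']
        linear_combination -(q (flipBit j x)) * h
      · refine ⟨_, smul_mem_pauliOps (mul_mem (opZ_mem j) (opX_mem j)) hω, op_ext fun q x => ?_⟩
        change phaseOp j ω q (flipBit j x) = phaseOp j ω (ω • opZ j (opX j q)) x
        rw [phaseOp_apply, phaseOp_apply, flipBit_same]
        change _ = _ * (ω * opZ j (opX j q) x)
        rw [opZ_apply, opX_apply]
        rcases fin2_cases (x j) with h' | h' <;> simp [h']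
        linear_combination (q (flipBit j x)) * h
    · refine ⟨_, opX_mem j, op_ext fun q x => ?_⟩
      change phaseOp i ω q (flipBit j x) = phaseOp i ω (opX j q) x
      rw [phaseOp_apply, phaseOp_apply, flipBit_ne (Ne.symm hj), opX_apply]
  · refine op_ext fun q x => ?_
    change opZ j (phaseOp i ω q) x = phaseOp i ω (opZ j q) x
    simp only [phaseOp_apply, opZ_apply]
    ring

theorem exists_mul_ctrlZ {i j : V} (hij : i ≠ j) :
    ∀ P ∈ pauliOps V, ∃ P' ∈ pauliOps V, P * toOp (ctrlZ i j) = toOp (ctrlZ i j) * P' := by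
  have happ : ∀ (q : Hil V) x, toOp (ctrlZ i j) q x =
      (if x i = 1 ∧ x j = 1 then -1 else 1) * q x := fun q x => ctrlZ_apply i j q x
  refine exists_mul_eq_of_generators (fun k => ?_) (fun k => ?_)
  · by_cases hi : k = i
    · subst hi
      refine ⟨_, mul_mem (opZ_mem j) (opX_mem k), op_ext fun q x => ?_⟩
      change toOp (ctrlZ k j) q (flipBit k x) = toOp (ctrlZ k j) (opZ j (opX k q)) x
      rw [happ, happ, opZ_apply, opX_apply, flipBit_same, flipBit_ne hij.symm]
      rcases fin2_cases (x k) with h | h <;> rcases fin2_cases (x j) with h' | h' <;> simp [h, h']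
    by_cases hj : k = j
    · subst hj
      refine ⟨_, mul_mem (opZ_mem i) (opX_mem k), op_ext fun q x => ?_⟩
      change toOp (ctrlZ i k) q (flipBit k x) = toOp (ctrlZ i k) (opZ i (opX k q)) x
      rw [happ, happ, opZ_apply, opX_apply, flipBit_same, flipBit_ne hij]
      rcases fin2_cases (x k) with h | h <;> rcases fin2_cases (x i) with h' | h' <;> simp [h, h']
    · refine ⟨_, opX_mem k, op_ext fun q x => ?_⟩
      change toOp (ctrlZ i j) q (flipBit k x) = toOp (ctrlZ i j) (opX k q) x
      rw [happ, happ, opX_apply, flipBit_ne (Ne.symm hi), flipBit_ne (Ne.symm hj)]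
  · refine op_ext fun q x => ?_
    change opZ k (toOp (ctrlZ i j) q) x = toOp (ctrlZ i j) (opZ k q) x
    simp only [happ, opZ_apply]
    ring

/-- The phase of `|1⟩` in the bra of the measurement at angle `θ` with outcome `b`. -/
def braPhase (θ : ℝ) (b : ZMod 2) : ℂ := (-1) ^ b.val * Complex.exp (-(θ * Complex.I))

theorem conj_measKet (θ : ℝ) (b : ZMod 2) (k : Fin 2) :
    (starRingEnd ℂ) (measKet θ b k) =
      (1 / (Real.sqrt 2 : ℂ)) * if k = 1 then braPhase θ b else 1 := by
  rcases fin2_cases k with rfl | rfl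
  · simp [measKet]
  · simp [measKet, braPhase, ← Complex.exp_conj]
    ring

/-- The bra sums over both values of the bit at `i` with a phase on `1`, and the result ignores that
bit: this is `1 + X_i` after a phase. -/
theorem braOp_measKet (i : V) (θ : ℝ) (b : ZMod 2) :
    braOp i (measKet θ b) =
      (1 / (Real.sqrt 2 : ℂ)) • ((1 + opX i) * phaseOp i (braPhase θ b)) := by
  refine op_ext fun q x => ?_
  rw [braOp_apply]
  simp only [conj_measKet]
  change _ = _ * (phaseOp i (braPhase θ b) q x + phaseOp i (braPhase θ b) q (flipBit i x))
  rw [phaseOp_apply, phaseOp_apply, flipBit_same, Fin.sum_univ_two]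
  rcases fin2_cases (x i) with h | h
  · have h1 : Function.update x i 0 = x := by rw [← h, Function.update_eq_self]
    have h2 : flipBit i x = Function.update x i 1 := by rw [flipBit, h, zero_add]
    simp [h, h1, h2]; ring
  · have h1 : Function.update x i 1 = x := by rw [← h, Function.update_eq_self]
    have h2 : flipBit i x = Function.update x i 0 := by rw [flipBit, h]; rfl
    simp [h, h1, h2]; ring

/-- Here the restriction to `M^x` and `M^y` enters: the actual angle is a multiple of `π/2` for all
signals. -/
theorem braPhase_pow_four {α : ℝ} (hα : α = 0 ∨ α = Real.pi / 2) (s t : Signal V) (Γ : Outcomes V)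
    (b : ZMod 2) : braPhase (actualAngle α s t Γ) b ^ 4 = 1 := by
  have h1 : ((-1 : ℂ) ^ b.val) ^ 4 = 1 := by
    rcases neg_one_pow_eq_or ℂ b.val with h | h <;> rw [h] <;> norm_num
  rw [braPhase, mul_pow, h1, one_mul, ← Complex.exp_nat_mul, Complex.exp_eq_one_iff, actualAngle]
  rcases hα with rfl | rfl
  · exact ⟨-2 * (t.value Γ).val, by push_cast; ring⟩
  · rcases neg_one_pow_eq_or ℝ (s.value Γ).val with h | h
    · exact ⟨-1 - 2 * (t.value Γ).val, by rw [h]; push_cast; ring⟩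
    · exact ⟨1 - 2 * (t.value Γ).val, by rw [h]; push_cast; ring⟩

theorem IsStabilizer.pauli_comp {A : Hil I →ₗ[ℂ] Hil V} (h : IsStabilizer A) {P : Op V}
    (hP : P ∈ pauliOps V) : IsStabilizer (P ∘ₗ A) := by
  refine h.isometry_comp (inner_pauliOps hP) fun P' hP' => ?_
  rcases pauliOps_signComm hP' hP with h | h
  · exact ⟨P', hP', h⟩
  · exact ⟨-P', neg_mem_pauliOps hP', by rw [h, mul_neg]⟩

theorem IsStabilizer.stepOp_comp {A : Hil I →ₗ[ℂ] Hil V} (h : IsStabilizer A) {c : Command V}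
    (hc : c.IsPauli) (Γ Γ' : Outcomes V) : IsStabilizer (stepOp Γ Γ' c ∘ₗ A) := by
  cases c with
  | ent i j hij => exact h.isometry_comp (inner_toOp _) (exists_mul_ctrlZ hij)
  | corrX i s => exact h.pauli_comp (pow_mem (opX_mem i) _)
  | corrZ i s => exact h.pauli_comp (pow_mem (opZ_mem i) _)
  | meas α i s t =>
    have hω := braPhase_pow_four hc s t Γ ((Γ' i).getD 0)
    change IsStabilizer (braOp i _ ∘ₗ A)
    rw [braOp_measKet, LinearMap.smul_comp]
    exact (((h.isometry_comp (inner_phaseOp i hω) (exists_mul_phaseOp i hω)).one_add_opX_comp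
      i).smul _)

theorem Step.exists_of_live {c : Command V} {S S' : CState V} (h : Step c S S') (q : Hil S.live) :
    ∃ q' : Hil S'.live, Step c ⟨S.live, q, S.outcomes⟩ ⟨S'.live, q', S'.outcomes⟩ := by
  cases h with
  | ent hij hi hj => exact ⟨_, .ent hij hi hj⟩
  | corrX hi hs => exact ⟨_, .corrX hi hs⟩
  | corrZ hi hs => exact ⟨_, .corrZ hi hs⟩
  | meas hi hs ht b => exact ⟨_, .meas hi hs ht b⟩

/-- A branch acts on all input states by a single linear operator. -/
theorem Exec.exists_linear {l : List (Command V)} {S S' : CState V} (h : Exec l S S')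
    (hl : ∀ c ∈ l, c.IsPauli) :
    ∃ L : Op V, (∀ A : Hil I →ₗ[ℂ] Hil V, IsStabilizer A → IsStabilizer (L ∘ₗ A)) ∧
      S'.vec = L S.vec ∧ ∀ q : Hil S.live, ∃ q' : Hil S'.live,
        Exec l ⟨S.live, q, S.outcomes⟩ ⟨S'.live, q', S'.outcomes⟩ ∧
        (⟨S'.live, q', S'.outcomes⟩ : CState V).vec =
          L (⟨S.live, q, S.outcomes⟩ : CState V).vec := by
  induction h with
  | nil S => exact ⟨1, fun A hA => hA, rfl, fun q => ⟨q, .nil _, rfl⟩⟩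
  | @cons c l S S' S'' hs _ ih =>
    obtain ⟨L, h1, h2, h3⟩ := ih fun c hc => hl c (List.mem_cons_of_mem _ hc)
    refine ⟨L * stepOp S.outcomes S'.outcomes c,
      fun A hA => h1 _ (hA.stepOp_comp (hl c List.mem_cons_self) _ _), ?_, fun q => ?_⟩
    · rw [h2, hs.vec_eq]; rfl
    · obtain ⟨q', hq'⟩ := hs.exists_of_live q
      obtain ⟨q'', hq'', hv⟩ := h3 q'
      exact ⟨q'', .cons hq' hq'', by rw [hv, hq'.vec_eq]; rfl⟩

theorem opX_comp_pullback (f : I ↪ V) (k : I) :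
    opX (f k) ∘ₗ pullback f = pullback f ∘ₗ opX k := by
  refine LinearMap.ext fun q => PiLp.ext fun x => ?_
  change q (flipBit (f k) x ∘ f) = q (flipBit k (x ∘ f))
  refine congrArg q (funext fun j => ?_)
  by_cases h : j = k
  · subst h; simp [flipBit]
  · simp [flipBit, h]

theorem opZ_comp_pullback (f : I ↪ V) (k : I) :
    opZ (f k) ∘ₗ pullback f = pullback f ∘ₗ opZ k := by
  refine LinearMap.ext fun q => PiLp.ext fun x => ?_
  change opZ (f k) (pullback f q) x = opZ k q (x ∘ f)
  rw [opZ_apply, opZ_apply]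
  rfl

theorem opX_comp_pullback_of_notMem (f : I ↪ V) {v : V} (hv : v ∉ Set.range f) :
    opX v ∘ₗ pullback f = pullback f := by
  refine LinearMap.ext fun q => PiLp.ext fun x => ?_
  change q (flipBit v x ∘ f) = q (x ∘ f)
  exact congrArg q (funext fun j => flipBit_ne (fun h => hv ⟨j, h⟩) x)

/-- `X` and `Z` on the image of `f` move to the right of the pullback, `X` elsewhere is absorbed
since those bits are ignored, and only `Z`s off the image remain on the left. -/
theorem exists_pauli_comp_pullback (f : I ↪ V) {P : Op V} (hP : P ∈ pauliOps V) :
    ∃ b : Finset V, (∀ v ∈ b, v ∉ Set.range f) ∧ ∃ P' ∈ pauliOps I,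
      P ∘ₗ pullback f = opZs b ∘ₗ pullback f ∘ₗ P' := by
  have hop : ∀ (M : Op V) (N : Op V) (A : Hil I →ₗ[ℂ] Hil V), (M * N) ∘ₗ A = M ∘ₗ N ∘ₗ A :=
    fun _ _ _ => rfl
  refine pauliOps_induction (p := fun P => ∃ b : Finset V, (∀ v ∈ b, v ∉ Set.range f) ∧
    ∃ P' ∈ pauliOps I, P ∘ₗ pullback f = opZs b ∘ₗ pullback f ∘ₗ P')
    ⟨∅, by simp, 1, one_mem _, by rw [opZs_empty]; rfl⟩ ?_ ?_ ?_ hP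
  · rintro v P - ⟨b, hb, P', hP', h⟩
    refine ⟨b, hb, ?_⟩
    have hX : ∃ Q ∈ pauliOps I, opX v ∘ₗ pullback f ∘ₗ P' = pullback f ∘ₗ Q := by
      by_cases hv : v ∈ Set.range f
      · obtain ⟨k, rfl⟩ := hv
        refine ⟨opX k * P', mul_mem (opX_mem k) hP', ?_⟩
        rw [← LinearMap.comp_assoc, opX_comp_pullback]; rfl
      · refine ⟨P', hP', ?_⟩
        rw [← LinearMap.comp_assoc, opX_comp_pullback_of_notMem f hv]
    obtain ⟨Q, hQ, hX⟩ := hX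
    rcases pauliOps_signComm (opX_mem v) (opZs_mem b) with hc | hc
    · exact ⟨Q, hQ, by rw [hop, h, ← hop, hc, hop, hX]⟩
    · exact ⟨-Q, neg_mem_pauliOps hQ, by
        rw [hop, h, ← hop, hc, LinearMap.neg_comp, hop, hX, LinearMap.comp_neg, LinearMap.comp_neg]⟩
  · rintro v P - ⟨b, hb, P', hP', h⟩
    by_cases hv : v ∈ Set.range f
    · obtain ⟨k, rfl⟩ := hv
      refine ⟨b, hb, opZ k * P', mul_mem (opZ_mem k) hP', ?_⟩
      have hc : opZ (f k) * opZs b = opZs b * opZ (f k) :=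
        op_ext fun q x => by
          change opZ (f k) (opZs b q) x = opZs b (opZ (f k) q) x
          simp only [opZ_apply, opZs_apply]
          ring
      rw [hop, h, ← hop, hc, hop, ← LinearMap.comp_assoc P', opZ_comp_pullback]; rfl
    · by_cases hvb : v ∈ b
      · refine ⟨b.erase v, fun w hw => hb w (Finset.mem_of_mem_erase hw), P', hP', ?_⟩
        rw [hop, h, ← hop, ← Finset.insert_erase hvb, ← opZ_mul_opZs (Finset.notMem_erase v b),
          ← mul_assoc, opZ_mul_self, one_mul, Finset.insert_erase hvb]
      · refine ⟨insert v b, ?_, P', hP', ?_⟩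
        · intro w hw
          rcases Finset.mem_insert.1 hw with rfl | hw
          · exact hv
          · exact hb w hw
        · rw [hop, h, ← hop, opZ_mul_opZs hvb]
  · rintro P - ⟨b, hb, P', hP', h⟩
    exact ⟨b, hb, _, I_smul_mem hP', by
      rw [LinearMap.smul_comp, h, LinearMap.comp_smul, LinearMap.comp_smul]⟩

theorem opX_opZs_anti {v : V} {b : Finset V} (hv : v ∈ b) :
    opX v * opZs b = -(opZs b * opX v) := by
  have hc : opX v * opZs (b.erase v) = opZs (b.erase v) * opX v := by
    generalize hb' : b.erase v = b'
    have hvb : v ∉ b' := hb' ▸ Finset.notMem_erase v b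
    clear hb' hv
    induction b' using Finset.induction_on with
    | empty => simp [opZs_empty]
    | insert w b' hw ih =>
      rw [Finset.mem_insert, not_or] at hvb
      rw [← opZ_mul_opZs hw, ← mul_assoc, (opX_opZ_comm hvb.1).eq, mul_assoc, ih hvb.2, mul_assoc]
  rw [← Finset.insert_erase hv, ← opZ_mul_opZs (Finset.notMem_erase v b), ← mul_assoc,
    opX_opZ_anti, neg_mul, mul_assoc, hc, mul_assoc]

/-- The quantity is the trace of `N`. A non-scalar Pauli anticommutes with some `X_i` or `Z_i`, and
conjugation by the latter preserves the trace while negating `N`. -/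
theorem hsInner_one_eq_zero {N : Op I} (hN : N ∈ pauliOps I) (h : ¬ ∃ c : ℂ, N = c • (1 : Op I)) :
    hsInner (1 : Op I) N = 0 := by
  have key : ∀ R : Op I, R ∈ pauliOps I → ¬ Commute N R →
      hsInner ((1 : Op I) ∘ₗ R) (N ∘ₗ R) = hsInner (1 : Op I) N → hsInner (1 : Op I) N = 0 := by
    intro R hR hc h1
    have h2 : N * R = -(R * N) := (pauliOps_signComm hN hR).resolve_left hc
    have h3 : N ∘ₗ R = -(R ∘ₗ N) := h2
    rw [h3, hsInner_neg_right] at h1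
    have h4 : hsInner (R ∘ₗ (1 : Op I)) (R ∘ₗ N) = hsInner (1 : Op I) N :=
      hsInner_comp (inner_pauliOps hR) _ _
    have h5 : (1 : Op I) ∘ₗ R = R ∘ₗ (1 : Op I) := rfl
    rw [h5, h4] at h1
    linear_combination -h1 / 2
  by_contra h0
  exact h (exists_eq_smul_one
    (fun i => by_contra fun hc => h0 (key _ (opX_mem i) hc (hsInner_comp_opX i _ _)))
    (fun i => by_contra fun hc => h0 (key _ (opZ_mem i) hc (hsInner_comp_opZ i _ _))))

/-- The number of extensions of a bit assignment is independent of the assignment. -/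
theorem exists_sum_comp_eq (f : I ↪ V) :
    ∃ K : ℂ, K ≠ 0 ∧ ∀ g : (I → Fin 2) → ℂ, ∑ x : V → Fin 2, g (x ∘ f) = K * ∑ y, g y := by
  refine ⟨((Finset.univ.filter fun x : V → Fin 2 => x ∘ f = 0).card : ℂ), ?_, fun g => ?_⟩
  · rw [Nat.cast_ne_zero, Finset.card_ne_zero]
    exact ⟨0, by simp⟩
  · rw [← Finset.sum_fiberwise Finset.univ (fun x : V → Fin 2 => x ∘ f), Finset.mul_sum]
    refine Finset.sum_congr rfl fun y _ => ?_
    rw [Finset.sum_congr rfl fun x hx => by rw [(Finset.mem_filter.1 hx).2], Finset.sum_const,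
      nsmul_eq_mul]
    congr 2
    have hy : Function.extend f y 0 ∘ f = y := funext fun i => f.injective.extend_apply _ _ i
    refine Finset.card_nbij' (fun x => x - Function.extend f y 0)
      (fun x => x + Function.extend f y 0) ?_ ?_ (fun x _ => by simp) (fun x _ => by simp)
    · intro x hx
      have hx : x ∘ f = y := by simpa using hx
      have : (x - Function.extend f y 0) ∘ f = x ∘ f - Function.extend f y 0 ∘ f := rfl
      simp [this, hx, hy]
    · intro x hx
      have hx : x ∘ f = 0 := by simpa using hx
      have : (x + Function.extend f y 0) ∘ f = x ∘ f + Function.extend f y 0 ∘ f := rfl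
      simp [this, hx, hy]

theorem exists_hsInner_pullback (f : I ↪ V) :
    ∃ K : ℂ, K ≠ 0 ∧ ∀ A B : Op I, hsInner (pullback f ∘ₗ A) (pullback f ∘ₗ B) = K * hsInner A B := by
  obtain ⟨K, hK, h⟩ := exists_sum_comp_eq f
  refine ⟨K, hK, fun A B => ?_⟩
  rw [hsInner, hsInner, Finset.mul_sum]
  refine Finset.sum_congr rfl fun y _ => ?_
  rw [PiLp.inner_apply, PiLp.inner_apply]
  exact h fun z => inner ℂ (A (basisKet y) z) (B (basisKet y) z)

/-- After the Paulis are moved through, a map `Z^b E (Q P)` remains, with `E` the pullback. For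
empty `b` the trace of the Pauli `Q P` decides. Otherwise `X_v` with `v ∈ b` fixes `E` and negates
the map, so the two are orthogonal. -/
theorem isStabilizer_pullback (f : I ↪ V) : IsStabilizer (pullback f) := by
  intro P hP P' hP'
  obtain ⟨b, hb, Q, hQ, h⟩ := exists_pauli_comp_pullback f hP'
  rw [← LinearMap.comp_assoc, h]
  by_cases hbe : b = ∅
  · rw [hbe, opZs_empty]
    change (∃ c : ℂ, pullback f ∘ₗ (Q * P) = c • pullback f) ∨
      hsInner (pullback f) (pullback f ∘ₗ (Q * P)) = 0
    by_cases hc : ∃ c : ℂ, Q * P = c • (1 : Op I)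
    · obtain ⟨c, hc⟩ := hc
      exact Or.inl ⟨c, by rw [hc, LinearMap.comp_smul]; rfl⟩
    · obtain ⟨K, -, hK⟩ := exists_hsInner_pullback f
      right
      have := hK 1 (Q * P)
      rw [hsInner_one_eq_zero (mul_mem hQ hP) hc, mul_zero] at this
      exact this
  · right
    obtain ⟨v, hv⟩ := Finset.nonempty_iff_ne_empty.2 hbe
    set E := pullback f with hE
    have hX : opX v ∘ₗ E = E := opX_comp_pullback_of_notMem f (hb v hv)
    set B := (opZs b ∘ₗ E ∘ₗ Q) ∘ₗ P
    have h1 : opX v ∘ₗ B = -B := by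
      calc opX v ∘ₗ B = (opX v * opZs b) ∘ₗ E ∘ₗ Q ∘ₗ P := rfl
        _ = -(opZs b ∘ₗ (opX v ∘ₗ E) ∘ₗ Q ∘ₗ P) := by rw [opX_opZs_anti hv]; rfl
        _ = -B := by rw [hX]; rfl
    have h2 := hsInner_opX_comp v E B
    rw [hX, h1, hsInner_neg_right] at h2
    linear_combination h2 / 2

theorem IsStabilizer.of_pullback_comp {f : I ↪ V} {N : Op I}
    (h : IsStabilizer (pullback f ∘ₗ N)) : IsStabilizer N := by
  intro P hP Q hQ
  have hlift : ∃ P' ∈ pauliOps V, P' ∘ₗ pullback f = pullback f ∘ₗ Q := by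
    refine pauliOps_induction (p := fun Q => ∃ P' ∈ pauliOps V,
      P' ∘ₗ pullback f = pullback f ∘ₗ Q) ⟨1, one_mem _, rfl⟩ ?_ ?_ ?_ hQ
    · rintro i Q - ⟨P', hP', h⟩
      refine ⟨opX (f i) * P', mul_mem (opX_mem _) hP', ?_⟩
      change opX (f i) ∘ₗ P' ∘ₗ _ = _
      rw [h, ← LinearMap.comp_assoc, opX_comp_pullback]; rfl
    · rintro i Q - ⟨P', hP', h⟩
      refine ⟨opZ (f i) * P', mul_mem (opZ_mem _) hP', ?_⟩
      change opZ (f i) ∘ₗ P' ∘ₗ _ = _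
      rw [h, ← LinearMap.comp_assoc, opZ_comp_pullback]; rfl
    · rintro Q - ⟨P', hP', h⟩
      exact ⟨_, I_smul_mem hP', by rw [LinearMap.smul_comp, h, LinearMap.comp_smul]⟩
  obtain ⟨P', hP', hl⟩ := hlift
  have e : P' ∘ₗ (pullback f ∘ₗ N) ∘ₗ P = pullback f ∘ₗ (Q ∘ₗ N ∘ₗ P) := by
    calc _ = (P' ∘ₗ pullback f) ∘ₗ N ∘ₗ P := rfl
      _ = _ := by rw [hl]; rfl
  rcases h P hP P' hP' with ⟨c, h⟩ | h
  · refine Or.inl ⟨c, LinearMap.ext fun q => pullback_injective f ?_⟩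
    rw [e] at h
    exact (LinearMap.congr_fun h q).trans (map_smul (pullback f) c (N q)).symm
  · obtain ⟨K, hK, h'⟩ := exists_hsInner_pullback f
    rw [e, h'] at h
    exact Or.inr ((mul_eq_zero.1 h).resolve_left hK)

theorem hsInner_toOp_self_ne_zero (U : Hil I ≃ₗᵢ[ℂ] Hil I) : hsInner (toOp U) (toOp U) ≠ 0 := by
  have : hsInner (toOp U) (toOp U) = ((Finset.univ : Finset (I → Fin 2)).card : ℂ) := by
    rw [hsInner, Finset.sum_congr rfl fun y _ => inner_toOp U _ _]
    simp
  rw [this, Nat.cast_ne_zero, Finset.card_ne_zero]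
  exact Finset.univ_nonempty

/-- Applying the relation twice gives `c² u = ±u`, because Paulis have squares `±1`. -/
theorem pow_four_of_intertwine {P Q u : Op I} (hP : P ∈ pauliOps I) (hQ : Q ∈ pauliOps I)
    (hu : IsUnit u) {c : ℂ} (h : Q * u * P = c • u) : c ^ 4 = 1 := by
  have h1 : Q * Q * u * (P * P) = (c * c) • u := by
    calc Q * Q * u * (P * P) = Q * (Q * u * P) * P := by simp only [mul_assoc]
      _ = (c * c) • u := by rw [h, mul_smul_comm, smul_mul_assoc, h, smul_smul]
  have hinj := smul_left_injective ℂ hu.ne_zero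
  have h2 : c * c = 1 ∨ c * c = -1 := by
    rcases pauliOps_mul_self hQ with hq | hq <;> rcases pauliOps_mul_self hP with hp | hp <;>
      rw [hq, hp] at h1
    · left; exact hinj (by simpa using h1.symm)
    · right; exact hinj (by simpa using h1.symm)
    · right; exact hinj (by simpa using h1.symm)
    · left; exact hinj (by simpa using h1.symm)
  rcases h2 with h2 | h2
  · linear_combination (c * c + 1) * h2
  · linear_combination (c * c - 1) * h2

/-- Fix `P`. If no `Q U P` were a multiple of `U`, all would be orthogonal to `U`, hence so would
every `N U P`, because the Paulis span. But `N = U P⁻¹ U⁻¹` gives `U` itself. So `Q U P = c U` with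
`c ^ 4 = 1`, and `U P U⁻¹ = c Q⁻¹` is Pauli. Fixing `Q` instead gives the other inclusion. -/
theorem mem_cliffordGroup_of_isStabilizer {U : Hil I ≃ₗᵢ[ℂ] Hil I} (h : IsStabilizer (toOp U)) :
    U ∈ cliffordGroup I := by
  have hU : toOp U * toOp U⁻¹ = 1 := by rw [← map_mul, mul_inv_cancel, map_one]
  have hU' : toOp U⁻¹ * toOp U = 1 := by rw [← map_mul, inv_mul_cancel, map_one]
  have hu : IsUnit (toOp U) := ⟨⟨_, _, hU, hU'⟩, rfl⟩
  have hspan : ∀ φ : Op I →ₗ[ℂ] Op I, (∀ R ∈ pauliOps I, hsInner (toOp U) (φ R) = 0) →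
      ∀ N, hsInner (toOp U) (φ N) = 0 := by
    intro φ hφ N
    induction mem_span_pauliOps N using Submodule.span_induction with
    | mem R hR => exact hφ R hR
    | zero => simp [hsInner]
    | add M N _ _ h1 h2 => rw [map_add, hsInner_add_right, h1, h2, add_zero]
    | smul c N _ h => rw [map_smul, hsInner_smul_right, h, mul_zero]
  rw [mem_cliffordGroup_iff]
  constructor
  · intro P hP
    obtain ⟨K, -, hPK, hKP⟩ := exists_pauliOps_inv hP
    have hex : ∃ Q ∈ pauliOps I, ∃ c : ℂ, Q * toOp U * P = c • toOp U := by
      by_contra hcon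
      push Not at hcon
      refine hsInner_toOp_self_ne_zero U ?_
      have := hspan (LinearMap.mulRight ℂ (toOp U * P)) (fun R hR => by
        rcases h P hP R hR with ⟨c, h⟩ | h
        · exact absurd h (hcon R hR c)
        · exact h) (toOp U * K * toOp U⁻¹)
      have e : toOp U * K * toOp U⁻¹ * (toOp U * P) = toOp U := by
        rw [mul_assoc, ← mul_assoc (toOp U⁻¹), hU', one_mul, mul_assoc, hKP, mul_one]
      rwa [LinearMap.mulRight_apply, e] at this
    obtain ⟨Q, hQ, c, hc⟩ := hex
    obtain ⟨Q', hQ', -, hQQ⟩ := exists_pauliOps_inv hQ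
    refine ⟨c • Q', smul_mem_pauliOps hQ' (pow_four_of_intertwine hP hQ hu hc), ?_⟩
    rw [smul_mul_assoc, ← mul_smul_comm, ← hc, ← mul_assoc, ← mul_assoc, hQQ, one_mul]
  · intro Q hQ
    obtain ⟨K, -, hQK, hKQ⟩ := exists_pauliOps_inv hQ
    have hex : ∃ P ∈ pauliOps I, ∃ c : ℂ, Q * toOp U * P = c • toOp U := by
      by_contra hcon
      push Not at hcon
      refine hsInner_toOp_self_ne_zero U ?_
      have := hspan (LinearMap.mulLeft ℂ (Q * toOp U)) (fun R hR => by
        rcases h R hR Q hQ with ⟨c, h⟩ | h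
        · exact absurd h (hcon R hR c)
        · exact h) (toOp U⁻¹ * (K * toOp U))
      have e : Q * toOp U * (toOp U⁻¹ * (K * toOp U)) = toOp U := by
        rw [mul_assoc, ← mul_assoc (toOp U), hU, one_mul, ← mul_assoc, hQK, one_mul]
      rwa [LinearMap.mulLeft_apply, e] at this
    obtain ⟨P, hP, c, hc⟩ := hex
    obtain ⟨P', hP', hPP, -⟩ := exists_pauliOps_inv hP
    refine ⟨c • P', smul_mem_pauliOps hP' (pow_four_of_intertwine hP hQ hu hc), ?_⟩
    rw [mul_smul_comm, ← smul_mul_assoc, ← hc, mul_assoc, hPP, mul_one]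

/-- A unitary implemented by a pattern with Pauli measurements is in the Clifford group. -/
theorem mem_cliffordGroup_of_implements {P : Pattern V I I} (hP : P.PauliMeasurements)
    {U : Hil I ≃ₗᵢ[ℂ] Hil I} (h : P.Implements U) : U ∈ cliffordGroup I := by
  obtain ⟨hdet, himp⟩ := h
  obtain ⟨κ, hκ, hprep⟩ := exists_vec_prep P
  -- One nonzero branch fixes the outcome map `Γ`; the same outcomes are then followed from every
  -- input.
  have hq₀ : (basisKet 0 : Hil I) ≠ 0 := by simp
  obtain ⟨q₀', ⟨hq₀', Γ, hex⟩, -⟩ := himp _ hq₀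
  obtain ⟨L, hL, hv, hlin⟩ := hex.exists_linear (I := I) hP
  change ∀ q : Hil (Finset.univ : Finset V), ∃ q' : Hil P.outputs, _ at hlin
  have hspec : ∀ q : Hil I, ∃ r : Hil I,
      Exec P.cmds ⟨Finset.univ, P.prep q, fun _ => none⟩ ⟨P.outputs, P.embedOut r, Γ⟩ ∧
        pullback P.out r = L (κ • pullback P.inp q) := by
    intro q
    obtain ⟨r', h1, h2⟩ := hlin (P.prep q)
    obtain ⟨r, rfl⟩ := embedOut_surjective P r'
    exact ⟨r, h1, by rw [← vec_embedOut P r Γ, ← hprep q fun _ => none]; exact h2⟩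
  choose R hR1 hR2 using hspec
  -- For some inputs these outcomes may lead to `0`, which is no branch; the scalar is then `0`.
  -- Otherwise determinism compares the run with the branch ending in a multiple of `U q`.
  have hRprop : ∀ q, ∃ c : ℂ, R q = c • U q := by
    intro q
    by_cases hq : q = 0
    · refine ⟨0, ?_⟩
      rw [zero_smul]
      apply pullback_injective P.out
      rw [hR2, hq, map_zero, map_zero, smul_zero, map_zero]
    by_cases hr : R q = 0
    · exact ⟨0, by rw [hr, zero_smul]⟩
    obtain ⟨q', hb, c, hc, hU⟩ := himp q hq
    obtain ⟨d, hd⟩ := hdet q q' (R q) hb ⟨hr, Γ, hR1 q⟩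
    have h0 : c * ((‖q‖ / ‖q'‖ : ℝ) : ℂ) ≠ 0 := by
      refine mul_ne_zero (norm_ne_zero_iff.1 (by rw [hc]; exact one_ne_zero)) ?_
      rw [Complex.ofReal_ne_zero]
      exact div_ne_zero (norm_ne_zero_iff.2 hq) (norm_ne_zero_iff.2 hb.1)
    refine ⟨d * (c * ((‖q‖ / ‖q'‖ : ℝ) : ℂ))⁻¹, ?_⟩
    rw [hU, hd, smul_smul, smul_smul, mul_assoc, inv_mul_cancel_right₀ h0]
  let N : Op I :=
    { toFun := R
      map_add' := fun p q => pullback_injective P.out (by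
        rw [hR2, map_add, map_add, smul_add, map_add, hR2, hR2])
      map_smul' := fun c q => pullback_injective P.out (by
        rw [RingHom.id_apply, map_smul (pullback P.out), hR2, hR2, map_smul (pullback P.inp),
          smul_comm, map_smul L]) }
  have hN : pullback P.out ∘ₗ N = L ∘ₗ (κ • pullback P.inp) := LinearMap.ext hR2
  have hU : toOp U * toOp U⁻¹ = 1 := by rw [← map_mul, mul_inv_cancel, map_one]
  -- Every vector is an eigenvector of `U⁻¹ N`, so this operator is a scalar.
  obtain ⟨a, ha⟩ := LinearMap.exists_eq_smul_id_of_forall_notLinearIndependent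
    (f := toOp U⁻¹ * N) (fun q hli => by
      obtain ⟨c, hc⟩ := hRprop q
      have h1 : (toOp U⁻¹ * N) q = c • q := by
        change toOp U⁻¹ (R q) = _
        rw [hc, map_smul]
        exact congrArg (c • ·) (U.symm_apply_apply q)
      rw [h1, LinearIndependent.pair_iff] at hli
      exact one_ne_zero (hli (-c) 1 (by rw [one_smul, neg_smul, neg_add_cancel])).2)
  have hNU : N = a • toOp U := by
    calc N = toOp U * (toOp U⁻¹ * N) := by rw [← mul_assoc, hU, one_mul]
      _ = _ := by rw [ha, mul_smul_comm, mul_one]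
  have ha0 : a ≠ 0 := by
    rintro rfl
    refine hq₀' (pullback_injective P.out ?_)
    rw [← vec_embedOut P q₀' Γ, hv, hprep]
    refine (hR2 _).symm.trans ?_
    rw [show R (basisKet 0) = N (basisKet 0) from rfl, hNU, zero_smul, LinearMap.zero_apply]
  have hst : IsStabilizer N := by
    refine IsStabilizer.of_pullback_comp (f := P.out) ?_
    rw [hN]
    exact hL _ ((isStabilizer_pullback P.inp).smul κ)
  refine mem_cliffordGroup_of_isStabilizer ?_
  have := hst.smul a⁻¹
  rwa [hNU, smul_smul, inv_mul_cancel₀ ha0, one_smul] at this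

end Stabilizer

/-! ### Measurement patterns for the gates and their composition. -/

section Realization

variable {Q : Type*} [DecidableEq Q] [Fintype Q]

/-- The constant signal `0`. -/
def Signal.zero (V : Type*) : Signal V := ⟨0, ∅⟩

/-- The outcome of the measurement at `i`, as a signal. -/
def Signal.outcome {V : Type*} (i : V) : Signal V := ⟨0, {i}⟩

theorem Signal.value_zero {V : Type*} (Γ : Outcomes V) : (Signal.zero V).value Γ = 0 := by
  simp [Signal.zero, Signal.value]

theorem Signal.value_outcome {V : Type*} (i : V) (Γ : Outcomes V) :
    (Signal.outcome i).value Γ = (Γ i).getD 0 := by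
  simp [Signal.outcome, Signal.value]

theorem actualAngle_zero {V : Type*} (α : ℝ) (Γ : Outcomes V) :
    actualAngle α (Signal.zero V) (Signal.zero V) Γ = α := by
  simp [actualAngle, Signal.value_zero]

/-- On a supply `F` of fresh qubits, there is a sequence of commands with Pauli measurements that
applies `u`, up to a nonzero scalar, to the state of the qubits `loc k`, and leaves the result on the
qubits `loc' k`, having measured all others. -/
def Realizable (u : Op Q) : Prop :=
  ∃ n : ℕ, ∀ (V : Type) [DecidableEq V] [Fintype V] (loc : Q ↪ V) (M F : Finset V),
    (∀ k, loc k ∉ M) → (∀ k, loc k ∉ F) → Disjoint F M → F.card = n →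
    ∃ (l : List (Command V)) (loc' : Q ↪ V),
      (∀ k, loc' k ∈ F ∨ loc' k ∈ Set.range loc) ∧
      (∀ v, v ∈ measured l ↔ (v ∈ F ∨ v ∈ Set.range loc) ∧ v ∉ Set.range loc') ∧
      WellFormed M l ∧ (∀ c ∈ l, c.IsPauli) ∧
      ∀ S S' : CState V, Exec l S S' → ∀ ψ : Hil Q, S.vec = pullback loc ψ →
        ∃ c : ℂ, c ≠ 0 ∧ S'.vec = c • pullback loc' (u ψ)

/-- The supply of fresh qubits is split in two, and the outputs of the pattern for `v` are the
inputs of the pattern for `u`. Fresh qubits need no separate preparation: a live qubit whose bit is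
ignored by the state is in a multiple of `|+⟩`. -/
theorem Realizable.mul {u v : Op Q} (hu : Realizable u) (hv : Realizable v) :
    Realizable (u * v) := by
  obtain ⟨m, hu⟩ := hu
  obtain ⟨n, hv⟩ := hv
  refine ⟨n + m, fun V _ _ loc M F hM hF hFM hcard => ?_⟩
  obtain ⟨F₂, hF₂, hc₂⟩ := Finset.exists_subset_card_eq (by omega : n ≤ F.card)
  have hc₁ : (F \ F₂).card = m := by rw [Finset.card_sdiff_of_subset hF₂]; omega
  obtain ⟨l₂, loc₂, hr₂, hm₂, hw₂, hp₂, he₂⟩ := hv V loc M F₂ hM (fun k h => hF k (hF₂ h))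
    (Finset.disjoint_of_subset_left hF₂ hFM) hc₂
  have hloc : ∀ w ∈ Set.range loc, w ∉ F ∧ w ∉ M := by
    rintro _ ⟨k, rfl⟩; exact ⟨hF k, hM k⟩
  have hFM' : ∀ w ∈ F, w ∉ M := fun w hw => Finset.disjoint_left.1 hFM hw
  obtain ⟨l₁, loc₁, hr₁, hm₁, hw₁, hp₁, he₁⟩ := hu V loc₂ (M ∪ measured l₂) (F \ F₂)
    (fun k h => by
      rcases Finset.mem_union.1 h with h | h
      · rcases hr₂ k with h' | h'
        · exact hFM' _ (hF₂ h') h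
        · exact (hloc _ h').2 h
      · exact ((hm₂ _).1 h).2 ⟨k, rfl⟩)
    (fun k h => by
      rw [Finset.mem_sdiff] at h
      rcases hr₂ k with h' | h'
      · exact h.2 h'
      · exact (hloc _ h').1 h.1)
    (by
      rw [Finset.disjoint_left]
      intro w hw h
      rw [Finset.mem_sdiff] at hw
      rcases Finset.mem_union.1 h with h | h
      · exact hFM' _ hw.1 h
      · rcases ((hm₂ _).1 h).1 with h' | h'
        · exact hw.2 h'
        · exact (hloc _ h').1 hw.1) hc₁
  have hr₂' : ∀ w ∈ Set.range loc₂, w ∈ F₂ ∨ w ∈ Set.range loc := by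
    rintro _ ⟨k, rfl⟩; exact hr₂ k
  have hr₁' : ∀ w ∈ Set.range loc₁, w ∈ F \ F₂ ∨ w ∈ Set.range loc₂ := by
    rintro _ ⟨k, rfl⟩; exact hr₁ k
  refine ⟨l₂ ++ l₁, loc₁, fun k => ?_, fun w => ?_, wellFormed_append.2 ⟨hw₂, hw₁⟩, ?_, ?_⟩
  · rcases hr₁ k with h | h
    · exact Or.inl (Finset.mem_sdiff.1 h).1
    · rcases hr₂' _ h with h | h
      · exact Or.inl (hF₂ h)
      · exact Or.inr h
  · rw [measured_append, Finset.mem_union, hm₂, hm₁]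
    have h1 := hr₂' w
    have h2 := hr₁' w
    have h3 := hloc w
    have h4 := @hF₂ w
    rw [Finset.mem_sdiff] at *
    tauto
  · intro c hc
    rcases List.mem_append.1 hc with hc | hc
    · exact hp₂ c hc
    · exact hp₁ c hc
  · intro S S'' h ψ hψ
    obtain ⟨S', h2, h1⟩ := h.of_append
    obtain ⟨c, hc, h2⟩ := he₂ S S' h2 ψ hψ
    obtain ⟨d, hd, h1⟩ := he₁ S' S'' h1 (c • v ψ) (by rw [h2, map_smul])
    exact ⟨d * c, mul_ne_zero hd hc, by
      rw [h1, map_smul, map_smul, smul_smul]; rfl⟩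

theorem realizable_smul_one {c : ℂ} (hc : c ≠ 0) : Realizable (c • (1 : Op Q)) := by
  refine ⟨0, fun V _ _ loc M F hM hF hFM hcard => ?_⟩
  rw [Finset.card_eq_zero] at hcard
  subst hcard
  refine ⟨[], loc, fun k => Or.inr ⟨k, rfl⟩, fun v => by simp [measured], trivial, by simp, ?_⟩
  intro S S' h ψ hψ
  cases h
  refine ⟨c⁻¹, inv_ne_zero hc, ?_⟩
  rw [LinearMap.smul_apply, map_smul, smul_smul, inv_mul_cancel₀ hc, one_smul, hψ]
  rfl

theorem comp_update_embedding {V : Type*} [DecidableEq V] (loc : Q ↪ V) (i : Q) (x : V → Fin 2)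
    (b : Fin 2) : Function.update x (loc i) b ∘ loc = Function.update (x ∘ loc) i b := by
  ext k
  by_cases h : k = i
  · subst h; simp
  · simp [h]

theorem opZ_pow_apply {V : Type*} [DecidableEq V] [Fintype V] (i : V) (n : ℕ) (q : Hil V)
    (x : V → Fin 2) : (opZ i ^ n) q x = (if x i = 1 then -1 else 1) ^ n * q x := by
  induction n generalizing q with
  | zero => simp
  | succ n ih =>
    rw [pow_succ, pow_succ]
    change (opZ i ^ n) (opZ i q) x = _
    rw [ih, opZ_apply, mul_assoc]

theorem zmod2_val_cases (b : ZMod 2) : b.val = 0 ∨ b.val = 1 := by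
  have := ZMod.val_lt b
  omega

/-- The commands `E`, `M^0`, `X` teleport the qubit `loc i` to `v` through a Hadamard operator. -/
theorem hadamard_teleport {V : Type*} [DecidableEq V] [Fintype V] (loc : Q ↪ V) (i : Q) {v : V}
    (hv : ∀ k, loc k ≠ v) {loc' : Q → V} (hloc' : loc' = Function.update loc i v) (b : ZMod 2)
    (ψ : Hil Q) :
    (opX v ^ b.val) (braOp (loc i) (measKet 0 b) (toOp (ctrlZ (loc i) v) (pullback loc ψ))) =
      (1 / (Real.sqrt 2 : ℂ)) • pullback loc' ((opX i + opZ i) ψ) := by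
  have hbra : ∀ x : V → Fin 2,
      braOp (loc i) (measKet 0 b) (toOp (ctrlZ (loc i) v) (pullback loc ψ)) x =
        (1 / (Real.sqrt 2 : ℂ)) * (ψ (Function.update (x ∘ loc) i 0) +
          (-1) ^ b.val * (if x v = 1 then -1 else 1) * ψ (Function.update (x ∘ loc) i 1)) := by
    intro x
    have happ : ∀ c : Fin 2, toOp (ctrlZ (loc i) v) (pullback loc ψ) (Function.update x (loc i) c) =
        (if c = 1 ∧ x v = 1 then -1 else 1) * ψ (Function.update (x ∘ loc) i c) := by
      intro c
      refine (ctrlZ_apply _ _ _ _).trans ?_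
      rw [Function.update_self, Function.update_of_ne (hv i).symm, pullback_apply,
        comp_update_embedding]
    rw [braOp_apply, Fin.sum_univ_two, conj_measKet, conj_measKet, happ, happ]
    simp [braPhase]
    split_ifs <;> ring
  have hflip : ∀ x : V → Fin 2, flipBit v x ∘ loc = x ∘ loc := fun x =>
    funext fun k => flipBit_ne (hv k) x
  have hpow : ∀ x : V → Fin 2,
      (opX v ^ b.val) (braOp (loc i) (measKet 0 b) (toOp (ctrlZ (loc i) v) (pullback loc ψ))) x =
        (1 / (Real.sqrt 2 : ℂ)) * (ψ (Function.update (x ∘ loc) i 0) +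
          (if x v = 1 then -1 else 1) * ψ (Function.update (x ∘ loc) i 1)) := by
    intro x
    rcases zmod2_val_cases b with hb | hb
    · rw [hb, pow_zero, Module.End.one_apply, hbra, hb, pow_zero, one_mul]
    · rw [hb, pow_one, opX_apply, hbra, hb, pow_one, hflip, flipBit_same]
      rcases fin2_cases (x v) with h | h <;> simp [h]
  refine PiLp.ext fun x => (hpow x).trans ?_
  change _ = _ * (opX i ψ (x ∘ loc') + opZ i ψ (x ∘ loc'))
  have hx : x ∘ loc' = Function.update (x ∘ loc) i (x v) := by
    rw [hloc', Function.comp_update]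
  rw [hx, opX_apply, opZ_apply, flipBit, Function.update_self, Function.update_idem]
  rcases fin2_cases (x v) with h | h <;> simp [h]; ring

theorem realizable_had (i : Q) : Realizable (opX i + opZ i) := by
  refine ⟨1, fun V _ _ loc M F hM hF hFM hcard => ?_⟩
  obtain ⟨v, rfl⟩ := Finset.card_eq_one.1 hcard
  have hv : ∀ k, loc k ≠ v := fun k h => hF k (by simp [h])
  have hvM : v ∉ M := by simpa using hFM
  have hinj : Function.Injective (Function.update loc i v) := by
    intro j k h
    by_cases hj : j = i <;> by_cases hk : k = i
    · rw [hj, hk]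
    · subst hj; rw [Function.update_self, Function.update_of_ne hk] at h; exact absurd h.symm (hv k)
    · subst hk; rw [Function.update_self, Function.update_of_ne hj] at h; exact absurd h (hv j)
    · rw [Function.update_of_ne hj, Function.update_of_ne hk] at h; exact loc.injective h
  refine ⟨[.ent (loc i) v (hv i), .meas 0 (loc i) (Signal.zero V) (Signal.zero V),
    .corrX v (Signal.outcome (loc i))], ⟨_, hinj⟩, fun k => ?_, fun w => ?_, ?_, ?_, ?_⟩
  · by_cases h : k = i
    · subst h; simp
    · right; exact ⟨k, (Function.update_of_ne h _ _).symm⟩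
  · simp only [measured, Command.measures, List.foldr_cons, List.foldr_nil, Finset.empty_union,
      Finset.union_empty, Finset.mem_singleton, Function.Embedding.coeFn_mk]
    constructor
    · rintro rfl
      refine ⟨Or.inr ⟨i, rfl⟩, ?_⟩
      rintro ⟨k, hk⟩
      by_cases h : k = i
      · subst h; rw [Function.update_self] at hk; exact hv k hk.symm
      · rw [Function.update_of_ne h] at hk; exact h (loc.injective hk)
    · rintro ⟨h | ⟨k, rfl⟩, h'⟩
      · exact absurd ⟨i, by rw [Function.update_self, h]⟩ h'
      · by_cases h : k = i
        · rw [h]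
        · exact absurd ⟨k, Function.update_of_ne h _ _⟩ h'
  · simp [WellFormed, Command.deps, Command.qubits, Command.measures, Signal.zero, Signal.outcome,
      hM, hvM, (hv i).symm]
  · simp [Command.IsPauli]
  · intro S S₃ h ψ hψ
    obtain ⟨S₁, h1, h⟩ := h.of_cons
    obtain ⟨S₂, h2, h⟩ := h.of_cons
    obtain ⟨S₃', h3, h⟩ := h.of_cons
    cases h
    refine ⟨1 / (Real.sqrt 2 : ℂ), by simp, ?_⟩
    rw [h3.vec_eq, h2.vec_eq, h1.vec_eq, hψ]
    simp only [stepOp, Signal.value_outcome, actualAngle_zero]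
    exact hadamard_teleport loc i hv rfl _ ψ

theorem wellFormed_of_forall {V : Type*} [DecidableEq V] [Fintype V] {M : Finset V} {l : List (Command V)}
    (h : ∀ c ∈ l, c.deps ⊆ M ∧ Disjoint c.qubits M ∧ c.measures = ∅) :
    WellFormed M l ∧ measured l = ∅ := by
  induction l with
  | nil => exact ⟨trivial, rfl⟩
  | cons c l ih =>
    obtain ⟨h1, h2⟩ := ih fun d hd => h d (List.mem_cons_of_mem _ hd)
    obtain ⟨h3, h4, h5⟩ := h c List.mem_cons_self
    refine ⟨⟨h3, h4, ?_⟩, ?_⟩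
    · rwa [h5, Finset.empty_union]
    · rw [measured_cons, h5, h2, Finset.empty_union]

theorem Exec.vec_ent_list {V : Type*} [DecidableEq V] [Fintype V] {loc : Q → V} {v : V}
    (hv : ∀ k, v ≠ loc k) {L : List Q} {S S' : CState V}
    (h : Exec (L.map fun j => Command.ent v (loc j) (hv j)) S S') (x : V → Fin 2) :
    S'.vec x = (if x v = 1 then (L.map fun j => if x (loc j) = 1 then (-1 : ℂ) else 1).prod else 1) *
      S.vec x := by
  induction L generalizing S with
  | nil => cases h; simp
  | cons j L ih =>
    obtain ⟨S₁, h1, h⟩ := h.of_cons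
    rw [ih h, h1.vec_eq]
    have : stepOp S.outcomes S₁.outcomes (Command.ent v (loc j) (hv j)) S.vec x =
      (if x v = 1 ∧ x (loc j) = 1 then -1 else 1) * S.vec x := ctrlZ_apply _ _ _ _
    rw [this]
    by_cases hx : x v = 1
    · simp only [hx, if_true, true_and, List.map_cons, List.prod_cons]; ring
    · simp [hx]

theorem Exec.vec_corrZ_list {V : Type*} [DecidableEq V] [Fintype V] {loc : Q → V} {s : Signal V}
    {L : List Q} {S S' : CState V} (h : Exec (L.map fun j => Command.corrZ (loc j) s) S S')
    (x : V → Fin 2) :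
    S'.vec x = (L.map fun j => if x (loc j) = 1 then (-1 : ℂ) else 1).prod ^ (s.value S.outcomes).val *
      S.vec x := by
  induction L generalizing S with
  | nil => cases h; simp
  | cons j L ih =>
    obtain ⟨S₁, h1, h⟩ := h.of_cons
    rw [ih h, h1.outcomes_eq rfl, h1.vec_eq]
    simp only [stepOp, opZ_pow_apply, List.map_cons, List.prod_cons]
    ring

theorem braPhase_pi_div_two (b : ZMod 2) :
    braPhase (Real.pi / 2) b = (-1) ^ b.val * -Complex.I := by
  rw [braPhase, Complex.exp_neg]
  push_cast
  rw [Complex.exp_pi_div_two_mul_I, Complex.inv_I]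

/-- Entangling the ancilla `v` with the qubits of `b` leaves `ψ` next to its `|0⟩` and `Z^b ψ` next
to its `|1⟩`. The bra at angle `π/2` then gives `(1 ∓ i Z^b) ψ` up to a scalar, and outcome `1` is
corrected by `Z^b`. -/
theorem realizable_phase (b : Finset Q) : Realizable (1 - Complex.I • opZs b) := by
  refine ⟨1, fun V _ _ loc M F hM hF hFM hcard => ?_⟩
  obtain ⟨v, rfl⟩ := Finset.card_eq_one.1 hcard
  have hv : ∀ k, v ≠ loc k := fun k h => hF k (by simp [h])
  have hvM : v ∉ M := by simpa using hFM
  set lE := b.toList.map fun j => Command.ent v (loc j) (hv j) with hlE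
  set lZ := b.toList.map fun j => Command.corrZ (loc j) (Signal.outcome v) with hlZ
  have hE := wellFormed_of_forall (M := M) (l := lE) (by
    intro c hc
    obtain ⟨j, -, rfl⟩ := List.mem_map.1 hc
    simp [Command.deps, Command.qubits, Command.measures, hM, hvM])
  have hZ := wellFormed_of_forall (M := {v} ∪ M) (l := lZ) (by
    intro c hc
    obtain ⟨j, -, rfl⟩ := List.mem_map.1 hc
    simp [Command.deps, Command.qubits, Command.measures, Signal.outcome, hM, (hv j).symm])
  refine ⟨lE ++ (.meas (Real.pi / 2) v (Signal.zero V) (Signal.zero V) :: lZ), loc,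
    fun k => Or.inr ⟨k, rfl⟩, fun w => ?_, ?_, ?_, ?_⟩
  · rw [measured_append, measured_cons, hE.2, hZ.2]
    simp only [Command.measures, Finset.empty_union, Finset.union_empty, Finset.mem_singleton]
    constructor
    · rintro rfl
      exact ⟨Or.inl rfl, fun ⟨k, hk⟩ => hv k hk.symm⟩
    · tauto
  · rw [wellFormed_append, hE.2, Finset.union_empty]
    refine ⟨hE.1, ?_, ?_, hZ.1⟩
    · simp [Command.deps, Signal.zero]
    · simp [Command.qubits, hvM]
  · intro c hc
    rcases List.mem_append.1 hc with hc | hc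
    · obtain ⟨j, -, rfl⟩ := List.mem_map.1 hc
      trivial
    · rcases List.mem_cons.1 hc with rfl | hc
      · exact Or.inr rfl
      · obtain ⟨j, -, rfl⟩ := List.mem_map.1 hc
        trivial
  · intro S S₃ h ψ hψ
    obtain ⟨S₁, h1, h⟩ := h.of_append
    obtain ⟨S₂, h2, h3⟩ := h.of_cons
    have hpar : ∀ x : V → Fin 2,
        (b.toList.map fun j => if x (loc j) = 1 then (-1 : ℂ) else 1).prod = parity b (x ∘ loc) :=
      fun x => Finset.prod_map_toList b _
    set o := (S₂.outcomes v).getD 0 with ho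
    have hupd : ∀ (x : V → Fin 2) c, Function.update x v c ∘ loc = x ∘ loc := fun x c =>
      funext fun k => Function.update_of_ne (hv k).symm _ _
    have hvec : ∀ x : V → Fin 2, S₃.vec x = parity b (x ∘ loc) ^ o.val *
        ((1 / (Real.sqrt 2 : ℂ)) *
          (1 + (-1) ^ o.val * -Complex.I * parity b (x ∘ loc)) * ψ (x ∘ loc)) := by
      intro x
      rw [h3.vec_corrZ_list, hpar, Signal.value_outcome, h2.vec_eq]
      congr 1
      simp only [stepOp, actualAngle_zero]
      rw [braOp_apply, Fin.sum_univ_two, conj_measKet, conj_measKet, h1.vec_ent_list,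
        h1.vec_ent_list, hpar, hpar, hψ, pullback_apply, pullback_apply, hupd, hupd,
        Function.update_self, Function.update_self, braPhase_pi_div_two]
      simp
      ring
    have hrhs : ∀ (c : ℂ) (x : V → Fin 2),
        (c • pullback loc ((1 - Complex.I • opZs b) ψ)) x =
          c * (ψ (x ∘ loc) - Complex.I * (parity b (x ∘ loc) * ψ (x ∘ loc))) := fun _ _ => rfl
    rcases zmod2_val_cases o with h0 | h0
    · refine ⟨1 / (Real.sqrt 2 : ℂ), by simp, PiLp.ext fun x => ?_⟩
      rw [hvec, hrhs, h0]
      ring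
    -- The extra factor `i` comes from `Z^b (1 + i Z^b) = i (1 - i Z^b)`.
    · refine ⟨Complex.I / (Real.sqrt 2 : ℂ), by simp, PiLp.ext fun x => ?_⟩
      rw [hvec, hrhs, h0]
      have hp := parity_sq b (x ∘ loc)
      linear_combination (Complex.I / (Real.sqrt 2 : ℂ) * ψ (x ∘ loc)) * hp +
        (1 / (Real.sqrt 2 : ℂ) * parity b (x ∘ loc) * ψ (x ∘ loc)) * Complex.I_mul_I

theorem realizable_of_mem_gateOps {u : Op Q} (hu : u ∈ gateOps Q) : Realizable u := by
  induction hu using Submonoid.closure_induction with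
  | mem g hg =>
    rcases hg with (⟨c, hc, rfl⟩ | ⟨b, rfl⟩) | ⟨i, rfl⟩
    · exact realizable_smul_one hc
    · exact realizable_phase b
    · exact realizable_had i
  | one => simpa using realizable_smul_one (Q := Q) one_ne_zero
  | mul u v _ _ hu hv => exact hu.mul hv

theorem WellFormed.definite {V I O : Type*} [DecidableEq V] [Fintype V] {P : Pattern V I O}
    (h : WellFormed ∅ P.cmds) (h2 : ∀ i : V, i ∈ measured P.cmds ↔ i ∉ Set.range P.out) :
    P.Definite := by
  have key : ∀ l₁ c l₂, P.cmds = l₁ ++ c :: l₂ → WellFormed (measured l₁) (c :: l₂) := by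
    intro l₁ c l₂ hl
    rw [hl, wellFormed_append, Finset.empty_union] at h
    exact h.2
  exact ⟨fun l₁ c l₂ hl => (key l₁ c l₂ hl).1, fun l₁ c l₂ hl => (key l₁ c l₂ hl).2.1, h2⟩

/-- A Clifford operator is implemented by a pattern with Pauli measurements. -/
theorem exists_pattern_of_mem_cliffordGroup {U : Hil Q ≃ₗᵢ[ℂ] Hil Q} (hU : U ∈ cliffordGroup Q) :
    ∃ (V : Type) (_ : Fintype V) (_ : DecidableEq V) (P : Pattern V Q Q),
      P.Definite ∧ P.PauliMeasurements ∧ P.Implements U := by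
  have hunit : IsUnit (toOp U) := (Group.isUnit U).map toOp
  obtain ⟨n, hn⟩ := realizable_of_mem_gateOps
    (mem_gateOps_of_normalizes hunit (mem_cliffordGroup_iff.1 hU).1)
  -- `Q` may live in any universe whereas `V : Type`, so `Q` is replaced by `Fin` of its
  -- cardinality; the second summand is the supply of ancillas.
  let V := Fin (Fintype.card Q) ⊕ Fin n
  let loc : Q ↪ V := (Fintype.equivFin Q).toEmbedding.trans Function.Embedding.inl
  obtain ⟨l, loc', -, hm, hw, hp, he⟩ := hn V loc ∅ (Finset.univ.map Function.Embedding.inr)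
    (by simp) (by intro k; simp [loc, Function.Embedding.inl, Function.Embedding.inr])
    (Finset.disjoint_empty_right _) (by simp)
  have hm' : ∀ v, v ∈ measured l ↔ v ∉ Set.range loc' := by
    intro v
    rw [hm]
    refine and_iff_right ?_
    rcases v with v | v
    · exact Or.inr ⟨(Fintype.equivFin Q).symm v, congrArg Sum.inl (Equiv.apply_symm_apply _ v)⟩
    · exact Or.inl (Finset.mem_map.2 ⟨v, Finset.mem_univ v, rfl⟩)
  let P : Pattern V Q Q := ⟨loc, loc', l⟩
  obtain ⟨κ, hκ, hprep⟩ := exists_vec_prep P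
  have hout : P.outputs = (∅ ∪ measured l)ᶜ := by
    ext v
    rw [Finset.empty_union, Finset.mem_compl, hm', not_not]
    simp [Pattern.outputs, P]
  -- Every run, whatever its outcomes, ends in a nonzero multiple of `U q`; determinism and
  -- implementation both follow.
  have hexec : ∀ (q q' : Hil Q) (Γ : Outcomes V),
      Exec l ⟨Finset.univ, P.prep q, fun _ => none⟩ ⟨P.outputs, P.embedOut q', Γ⟩ →
      ∃ c : ℂ, c ≠ 0 ∧ q' = c • U q := by
    intro q q' Γ h
    obtain ⟨c, hc, hv⟩ := he _ _ h (κ • q) (by rw [hprep, map_smul])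
    refine ⟨c * κ, mul_ne_zero hc hκ, pullback_injective loc' ?_⟩
    rw [map_smul (pullback loc')]
    refine hv.trans ?_
    rw [map_smul, map_smul, smul_smul, toOp_apply]
  refine ⟨V, inferInstance, inferInstance, P, hw.definite hm', hp, ?_, ?_⟩
  · rintro q q' q'' ⟨-, Γ', h'⟩ ⟨-, Γ'', h''⟩
    obtain ⟨c, hc, rfl⟩ := hexec _ _ _ h'
    obtain ⟨d, -, rfl⟩ := hexec _ _ _ h''
    exact ⟨d * c⁻¹, by rw [smul_smul, inv_mul_cancel_right₀ hc]⟩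
  · intro q hq
    have hadm : Admissible ∅ (⟨Finset.univ, P.prep q, fun _ => none⟩ : CState V) :=
      ⟨by simp, by simp⟩
    obtain ⟨⟨W, r, Γ⟩, hS⟩ := Exec.exists hadm hw
    obtain rfl : W = P.outputs := (hS.admissible hadm).1.trans hout.symm
    obtain ⟨q', rfl⟩ := embedOut_surjective P r
    obtain ⟨c, hc, rfl⟩ := hexec _ _ _ hS
    have hUq : U q ≠ 0 := by simpa using hq
    have hnc : ‖c‖ ≠ 0 := norm_ne_zero_iff.2 hc
    have hnq : ‖q‖ ≠ 0 := norm_ne_zero_iff.2 hq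
    -- The output is `c • U q`, so renormalising leaves the phase `c / ‖c‖`, which the witness
    -- inverts.
    refine ⟨_, ⟨smul_ne_zero hc hUq, Γ, hS⟩, (‖c‖ : ℂ) / c, ?_, ?_⟩
    · rw [norm_div, Complex.norm_real, norm_norm, div_self hnc]
    · have h1 : ‖q‖ / ‖c • U q‖ = ‖c‖⁻¹ := by
        rw [norm_smul, U.norm_map]
        field_simp
      have hnc' : (‖c‖ : ℂ) ≠ 0 := Complex.ofReal_ne_zero.2 hnc
      rw [h1, smul_smul, smul_smul, Complex.ofReal_inv]
      have : (‖c‖ : ℂ) / c * (‖c‖ : ℂ)⁻¹ * c = 1 := by field_simp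
      rw [this, one_smul]

end Realization

end OneWay

end

theorem mainTheorem2 {Q : Type*} [Fintype Q] [DecidableEq Q]
    (U : OneWay.Hil Q ≃ₗᵢ[ℂ] OneWay.Hil Q) :
    U ∈ OneWay.cliffordGroup Q ↔
      ∃ (V : Type) (_ : Fintype V) (_ : DecidableEq V) (P : OneWay.Pattern V Q Q),
        P.Definite ∧ P.PauliMeasurements ∧ P.Implements U := by
  refine ⟨OneWay.exists_pattern_of_mem_cliffordGroup, ?_⟩
  rintro ⟨V, _, _, P, -, hP, hU⟩
  exact OneWay.mem_cliffordGroup_of_implements hP hU
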